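/- Let $G$ be a finite group with identity element $e$, and for $X\subseteq G$ write $\underline{X}=\sum_{x\in X}x\in\mathbb{Z}G$. A subring $\mathcal{A}$ of the integer group ring $\mathbb{Z}G$ is called an $S$-ring over $G$ if there is a partition $\mathcal{S}$ of $G$ such that $\{e\}\in\mathcal{S}$, $X^{-1}\in\mathcal{S}$ for every $X\in\mathcal{S}$, and $\mathcal{A}=\mathrm{Span}_{\mathbb{Z}}\{\underline{X}: X\in\mathcal{S}\}$. The $S$-ring $\mathcal{A}$ is called schurian if there is a permutation group $\Gamma$ with $G_{right}\le\Gamma\le \mathrm{Sym}(G)$, where $G_{right}=\{x\mapsto xg : g\in G\}$, such that $\mathcal{A}=\mathrm{Span}_{\mathbb{Z}}\{\underline{X}: X\in \mathrm{Orb}(\Gamma_e,G)\}$, where $\mathrm{Orb}(\Gamma_e,G)$ is the set of orbits on $G$ of the stabilizer $\Gamma_e$ of $e$ in $\Gamma$. A finite group $G$ is called a Schur group if every $S$-ring over $G$ is schurian. **Corollary.** Let $p$ be an odd prime. Then every Schur group that is a $p$-group is abelian. -/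

import Mathlib

namespace SchurRing

variable {G : Type*} [Group G]

/-- The element `∑_{x ∈ X} x` of the integer group ring `ℤG`. It is used for finite groups `G` only,
so that the sum is always finite. -/
noncomputable def setSum (X : Set G) : MonoidAlgebra ℤ G :=
  ∑ᶠ x ∈ X, MonoidAlgebra.of ℤ G x

/-- The `ℤ`-submodule of `ℤG` spanned by the elements `setSum X`, for `X` in the family `S`. -/
noncomputable def spanOf (S : Set (Set G)) : Submodule ℤ (MonoidAlgebra ℤ G) :=
  Submodule.span ℤ (setSum '' S)

/-- A subring `A` of `ℤG` is an `S`-ring over `G` if there is a partition `S` of `G` which contains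
`{e}`, is closed under `X ↦ X⁻¹`, and is such that `A` is the `ℤ`-span of the sums of the members
of `S`. -/
def IsSRing (A : Subring (MonoidAlgebra ℤ G)) : Prop :=
  ∃ S : Set (Set G), Setoid.IsPartition S ∧
    ({1} : Set G) ∈ S ∧
    (∀ X ∈ S, {x : G | x⁻¹ ∈ X} ∈ S) ∧
    AddSubgroup.toIntSubmodule A.toAddSubgroup = spanOf S

variable (G) in
/-- The group of right shifts `x ↦ x * g`, as a subgroup of `Sym(G)`. -/
def rightShifts : Subgroup (Equiv.Perm G) where
  carrier := Set.range fun g : G => Equiv.mulRight g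
  one_mem' := ⟨1, by ext x; simp⟩
  mul_mem' := by
    rintro _ _ ⟨g, rfl⟩ ⟨h, rfl⟩
    exact ⟨h * g, by ext x; simp [mul_assoc]⟩
  inv_mem' := by
    rintro _ ⟨g, rfl⟩
    exact ⟨g⁻¹, by ext x; simp⟩

/-- The set of orbits on `G` of the stabilizer of the identity element in `Γ`. -/
def stabilizerOrbits (Γ : Subgroup (Equiv.Perm G)) : Set (Set G) :=
  Set.range fun x : G => MulAction.orbit (MulAction.stabilizer Γ (1 : G)) x

/-- `A` is schurian if it is the `ℤ`-span of the sums of the orbits on `G` of the stabilizer of the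
identity element in some `Γ` with `G_right ≤ Γ ≤ Sym(G)`. -/
def IsSchurian (A : Subring (MonoidAlgebra ℤ G)) : Prop :=
  ∃ Γ : Subgroup (Equiv.Perm G), rightShifts G ≤ Γ ∧
    AddSubgroup.toIntSubmodule A.toAddSubgroup = spanOf (stabilizerOrbits Γ)

variable (G) in
/-- A Schur group is a finite group over which every `S`-ring is schurian. -/
def IsSchurGroup : Prop :=
  Finite G ∧ ∀ A : Subring (MonoidAlgebra ℤ G), IsSRing A → IsSchurian A

end SchurRing

/-! ### Simple quantities and S-families: the combinatorial form of an S-ring. -/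

namespace SchurRing

variable {G : Type*} [Group G]

/-! The Schur property is used only through one consequence, `IsSchurFamilyGroup`: points that an
S-family cannot separate are exchanged by an automorphism of its Cayley scheme fixing the identity.
Families closed under intersection replace partitions because the natural generators (subgroups,
unions of cosets) overlap, and their products are easy to expand.

This consequence passes to subgroups (`of_injective`) and to quotients (`of_surjective`). A
nonabelian p-group of least order that has it is therefore minimal nonabelian with all proper
quotients abelian: its commutators are central, have p-th power 1 and lie in every nontrivial
central subgroup, and any two noncommuting elements generate it. It remains to give such a group an
S-family with two unseparated points that no automorphism exchanges.

For p > 3, take the centre and the centralizers of a, b and ab. Modulo the centre the centralizers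
are three parallel classes of lines in an affine plane. An automorphism respects all three, which is
too rigid to send ab² to ab³ while fixing 1 (`not_isSchurFamilyGroup_of_not_commute_pow`).

For p = 3 there are too few lines. Choosing a noncentral b of order 3
(`exists_not_mem_center_cube_eq_one`) leads to one of the two nonabelian groups of order 27 as a
subgroup, or to a larger modular 3-group. The former carry rank-four S-rings from antipodal
distance-regular graphs, excluded by a finite search. The latter carries a family made of cosets of
subgroups of order 3; in coordinates an automorphism becomes a system of affine maps of `ZMod 3`,
indexed by the level, whose wrap-around is inconsistent (`false_of_shift_system`). -/

theorem setSum_empty : setSum (∅ : Set G) = 0 := by simp [setSum]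

theorem setSum_singleton (x : G) : setSum ({x} : Set G) = MonoidAlgebra.of ℤ G x := by
  simp [setSum]

section Coefficients

variable [Finite G]

open Classical in
theorem coeff_setSum (X : Set G) (x : G) : (setSum X).coeff x = if x ∈ X then 1 else 0 := by
  have hX := X.toFinite
  rw [setSum, finsum_mem_eq_finite_toFinset_sum _ hX, MonoidAlgebra.coeff_sum,
    Finsupp.finsetSum_apply]
  simp [MonoidAlgebra.of_apply, Finsupp.single_apply]

theorem setSum_eq_of_coeff {X : Set G} {y : MonoidAlgebra ℤ G}
    (h1 : ∀ x ∈ X, y.coeff x = 1) (h0 : ∀ x ∉ X, y.coeff x = 0) : y = setSum X := by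
  classical
  ext x
  rw [coeff_setSum]
  split_ifs with h
  · exact h1 x h
  · exact h0 x h

theorem setSum_diff (X Y : Set G) : setSum (X \ Y) = setSum X - setSum (X ∩ Y) := by
  classical
  symm
  apply setSum_eq_of_coeff <;> intro x hx <;>
    simp only [MonoidAlgebra.coeff_sub, Finsupp.sub_apply, coeff_setSum, Set.mem_inter_iff,
      Set.mem_sdiff, not_and, not_not] at hx ⊢
  · simp [hx]
  · by_cases h : x ∈ X
    · simp [h, hx h]
    · simp [h]

theorem setSum_union {X Y : Set G} (h : Disjoint X Y) :
    setSum (X ∪ Y) = setSum X + setSum Y := by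
  have := setSum_diff (X ∪ Y) X
  rw [Set.union_sdiff_cancel_left (Set.disjoint_iff.1 h), Set.union_inter_cancel_left] at this
  rw [this]
  abel

end Coefficients

/-- Two elements are not separated by any member of the family `F`. -/
def Unseparated {α : Type*} (F : Set (Set α)) (x y : α) : Prop := ∀ M ∈ F, x ∈ M ↔ y ∈ M

/-- A family of subsets of `G` that is closed under nonempty intersections and whose sums span
a subring of the group ring. The span is then an `S`-ring over `G`, the basic sets of which are the
classes of elements which are not separated by `F`. -/
structure IsSFamily (F : Set (Set G)) : Prop where
  one_mem : {1} ∈ F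
  cover : ∀ x, ∃ M ∈ F, x ∈ M
  inv_mem : ∀ M ∈ F, {x : G | x⁻¹ ∈ M} ∈ F
  inter_mem : ∀ M ∈ F, ∀ N ∈ F, (M ∩ N).Nonempty → M ∩ N ∈ F
  mul_mem : ∀ M ∈ F, ∀ N ∈ F, setSum M * setSum N ∈ spanOf F

variable (G) in
/-- Every two elements not separated by an `S`-family are conjugate under a permutation
that fixes the identity and preserves the Cayley relations of all members of the family. -/
def IsSchurFamilyGroup : Prop :=
  ∀ F : Set (Set G), IsSFamily F → ∀ x y, Unseparated F x y →
    ∃ f : Equiv.Perm G, f 1 = 1 ∧ f x = y ∧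
      ∀ M ∈ F, ∀ u v, v * u⁻¹ ∈ M ↔ f v * (f u)⁻¹ ∈ M

/-- The partition into classes of elements which are not separated by `F`. -/
theorem isPartition_classes {α : Type*} (F : Set (Set α)) : Setoid.IsPartition (Set.range fun x => {y | Unseparated F x y}) := by
  constructor
  · rintro ⟨x, hx⟩
    have : x ∈ {y | Unseparated F x y} := fun M _ => Iff.rfl
    simp only at hx
    rw [hx] at this
    exact this
  · intro x
    refine ⟨{y | Unseparated F x y}, ⟨⟨x, rfl⟩, fun M _ => Iff.rfl⟩, ?_⟩
    rintro _ ⟨⟨y, rfl⟩, hy⟩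
    ext z
    exact ⟨fun h M hM => (hy M hM).symm.trans (h M hM), fun h M hM => (hy M hM).trans (h M hM)⟩

theorem IsSFamily.mul_mem_spanOf {F : Set (Set G)} (hF : IsSFamily F) {v w : MonoidAlgebra ℤ G} (hv : v ∈ spanOf F) (hw : w ∈ spanOf F) :
    v * w ∈ spanOf F := by
  have h : spanOf F * spanOf F ≤ spanOf F := by
    rw [spanOf, Submodule.span_mul_span, Submodule.span_le]
    rintro _ ⟨_, ⟨M, hM, rfl⟩, _, ⟨N, hN, rfl⟩, rfl⟩
    exact hF.mul_mem M hM N hN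
  exact h (Submodule.mul_mem_mul hv hw)

theorem setSum_mem_spanOf {F : Set (Set G)} {M : Set G} (hM : M ∈ F) : setSum M ∈ spanOf F :=
  Submodule.subset_span ⟨M, hM, rfl⟩

section

variable [Finite G]

theorem Unseparated.coeff_eq {F : Set (Set G)} {x y : G} (h : Unseparated F x y)
    {w : MonoidAlgebra ℤ G} (hw : w ∈ spanOf F) : w.coeff x = w.coeff y := by
  classical
  induction hw using Submodule.span_induction with
  | mem w hw =>
    obtain ⟨M, hM, rfl⟩ := hw
    simp only [coeff_setSum, h M hM]
  | zero => rfl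
  | add v w _ _ hv hw => simp [hv, hw]
  | smul a w _ hw => simp only [MonoidAlgebra.coeff_smul, Finsupp.smul_apply, hw]

theorem mem_iff_of_setSum_mem {F : Set (Set G)} {x y : G} (h : Unseparated F x y) {M : Set G}
    (hM : setSum M ∈ spanOf F) : x ∈ M ↔ y ∈ M := by
  classical
  have := h.coeff_eq hM
  simp only [coeff_setSum] at this
  by_cases hx : x ∈ M <;> by_cases hy : y ∈ M <;> simp_all

namespace IsSFamily

variable {F : Set (Set G)} (hF : IsSFamily F)
include hF

/-- Inclusion–exclusion, removing one member at a time: closure under intersection lets the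
induction apply to `M ∩ N` as well as to `M`. -/
theorem setSum_diff_sUnion_mem {T : Set (Set G)} (hT : T ⊆ F) {M : Set G} (hM : M ∈ F) :
    setSum (M \ ⋃₀ T) ∈ spanOf F := by
  induction T, T.toFinite using Set.Finite.induction_on generalizing M with
  | empty => simpa using setSum_mem_spanOf hM
  | @insert N T _ _ ih =>
    have hT' : T ⊆ F := fun X hX => hT (Set.mem_insert_of_mem _ hX)
    have key : setSum (M \ ⋃₀ insert N T) = setSum (M \ ⋃₀ T) - setSum ((M ∩ N) \ ⋃₀ T) := by
      rw [Set.sUnion_insert, Set.union_comm, ← Set.sdiff_sdiff, setSum_diff]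
      congr 2
      ext x
      simp only [Set.mem_inter_iff, Set.mem_sdiff]
      tauto
    rw [key]
    refine Submodule.sub_mem _ (ih hT' hM) ?_
    by_cases hne : (M ∩ N).Nonempty
    · exact ih hT' (hF.inter_mem M hM N (hT (Set.mem_insert _ _)) hne)
    · rw [Set.not_nonempty_iff_eq_empty.1 hne, Set.empty_sdiff, setSum_empty]
      exact Submodule.zero_mem _

theorem exists_least (x : G) : ∃ M ∈ F, x ∈ M ∧ ∀ N ∈ F, x ∈ N → M ⊆ N := by
  obtain ⟨M, ⟨hM, hx⟩, hmin⟩ := Set.exists_min_image {M | M ∈ F ∧ x ∈ M} Set.ncard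
    (Set.toFinite _) (hF.cover x)
  refine ⟨M, hM, hx, fun N hN hxN => ?_⟩
  have h := hmin (M ∩ N) ⟨hF.inter_mem M hM N hN ⟨x, hx, hxN⟩, hx, hxN⟩
  exact Set.inter_eq_left.1 (Set.eq_of_subset_of_ncard_le Set.inter_subset_left h)

/-- The class of `x` is the least member containing `x` with all members avoiding `x` removed. -/
theorem setSum_class_mem (x : G) : setSum {y | Unseparated F x y} ∈ spanOf F := by
  obtain ⟨M, hM, hx, hmin⟩ := hF.exists_least x
  have : {y | Unseparated F x y} = M \ ⋃₀ {N | N ∈ F ∧ x ∉ N} := by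
    ext y
    simp only [Set.mem_ofPred_eq, Set.mem_sdiff, Set.mem_sUnion, not_exists, not_and]
    constructor
    · intro h
      exact ⟨(h M hM).1 hx, fun N hN hy => hN.2 ((h N hN.1).2 hy)⟩
    · rintro ⟨hy, h⟩ N hN
      exact ⟨fun hxN => hmin N hN hxN hy, fun hyN => by_contra fun hxN => h N ⟨hN, hxN⟩ hyN⟩
  rw [this]
  exact hF.setSum_diff_sUnion_mem (fun N hN => hN.1) hM

theorem spanOf_classes :
    spanOf (Set.range fun x => {y | Unseparated F x y}) = spanOf F := by
  classical
  apply le_antisymm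
  · rw [spanOf, Submodule.span_le]
    rintro _ ⟨_, ⟨x, rfl⟩, rfl⟩
    exact hF.setSum_class_mem x
  · rw [spanOf, Submodule.span_le]
    rintro _ ⟨M, hM, rfl⟩
    let T : Set (Set G) := (fun x => {y | Unseparated F x y}) '' M
    have hT : T.Finite := Set.toFinite _
    have : setSum M = ∑ X ∈ hT.toFinset, setSum X := by
      symm
      apply setSum_eq_of_coeff
      · intro x hx
        rw [MonoidAlgebra.coeff_sum, Finsupp.finsetSum_apply,
          Finset.sum_eq_single {y | Unseparated F x y}]
        · rw [coeff_setSum]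
          exact if_pos fun M _ => Iff.rfl
        · intro X hX hne
          rw [coeff_setSum, if_neg]
          intro hxX
          obtain ⟨y, -, rfl⟩ := hT.mem_toFinset.1 hX
          refine hne (Set.ext fun z => ?_)
          exact ⟨fun h M hM => (hxX M hM).symm.trans (h M hM),
            fun h M hM => (hxX M hM).trans (h M hM)⟩
        · intro h
          exact absurd (hT.mem_toFinset.2 ⟨x, hx, rfl⟩) h
      · intro x hx
        rw [MonoidAlgebra.coeff_sum, Finsupp.finsetSum_apply]
        refine Finset.sum_eq_zero fun X hX => ?_
        obtain ⟨y, hy, rfl⟩ := hT.mem_toFinset.1 hX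
        rw [coeff_setSum, if_neg]
        exact fun h => hx ((h M hM).1 hy)
    rw [this]
    refine Submodule.sum_mem _ fun X hX => ?_
    obtain ⟨y, hy, rfl⟩ := hT.mem_toFinset.1 hX
    exact setSum_mem_spanOf ⟨y, rfl⟩

theorem exists_isSRing : ∃ A : Subring (MonoidAlgebra ℤ G), IsSRing A ∧
    AddSubgroup.toIntSubmodule A.toAddSubgroup = spanOf F := by
  let A : Subring (MonoidAlgebra ℤ G) :=
    { carrier := spanOf F
      mul_mem' := hF.mul_mem_spanOf
      one_mem' := by
        have := setSum_mem_spanOf hF.one_mem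
        rwa [setSum_singleton, map_one] at this
      add_mem' := Submodule.add_mem _
      zero_mem' := Submodule.zero_mem _
      neg_mem' := Submodule.neg_mem _ }
  have hA : AddSubgroup.toIntSubmodule A.toAddSubgroup = spanOf F := by
    ext w
    exact Iff.rfl
  refine ⟨A, ⟨_, isPartition_classes F, ⟨1, ?_⟩, ?_, hA.trans hF.spanOf_classes.symm⟩, hA⟩
  · ext y
    refine ⟨fun h => (h _ hF.one_mem).1 rfl, ?_⟩
    rintro rfl M _
    exact Iff.rfl
  · rintro _ ⟨x, rfl⟩
    refine ⟨x⁻¹, ?_⟩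
    ext y
    constructor
    · intro h M hM
      simpa using h _ (hF.inv_mem M hM)
    · intro h M hM
      simpa using h _ (hF.inv_mem M hM)

end IsSFamily

/-- The S-ring spanned by the family is also spanned by the orbits of a point stabilizer, so
unseparated points share an orbit. Members of the family are unions of orbits, and right shifts
carry this invariance from the point 1 to every base point. -/
theorem IsSchurGroup.isSchurFamilyGroup (hG : IsSchurGroup G) : IsSchurFamilyGroup G := by
  intro F hF x y hxy
  obtain ⟨A, hA, hAF⟩ := hF.exists_isSRing
  obtain ⟨Γ, hΓ, hAΓ⟩ := hG.2 A hA
  have hspan : spanOf F = spanOf (stabilizerOrbits Γ) := hAF.symm.trans hAΓ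
  have hstab : ∀ g : Γ, (g : Equiv.Perm G) 1 = 1 → ∀ M ∈ F, ∀ z : G,
      z ∈ M ↔ (g : Equiv.Perm G) z ∈ M := by
    intro g hg M hM z
    refine mem_iff_of_setSum_mem (F := stabilizerOrbits Γ) ?_
      (hspan ▸ setSum_mem_spanOf hM)
    rintro _ ⟨w, rfl⟩
    have : (g : Equiv.Perm G) z = (⟨g, hg⟩ : MulAction.stabilizer Γ (1 : G)) • z := rfl
    rw [this]
    refine ⟨MulAction.mem_orbit_of_mem_orbit _, fun h => ?_⟩
    simpa using MulAction.mem_orbit_of_mem_orbit (⟨g, hg⟩ : MulAction.stabilizer Γ (1 : G))⁻¹ h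
  have hyO : y ∈ MulAction.orbit (MulAction.stabilizer Γ (1 : G)) x :=
    (mem_iff_of_setSum_mem hxy (M := MulAction.orbit (MulAction.stabilizer Γ (1 : G)) x)
      (hspan ▸ setSum_mem_spanOf ⟨x, rfl⟩)).1 (MulAction.mem_orbit_self x)
  obtain ⟨⟨f, hf1⟩, hfx⟩ := hyO
  refine ⟨f, hf1, hfx, fun M hM u v => ?_⟩
  have hr : ∀ g : G, Equiv.mulRight g ∈ Γ := fun g => hΓ ⟨g, rfl⟩
  -- Conjugating `f` by right shifts gives an element that fixes 1 and sends `v * u⁻¹` to `f v * (f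
  -- u)⁻¹`.
  let h : Γ := ⟨Equiv.mulRight ((f : Equiv.Perm G) u)⁻¹, hr _⟩ * f * ⟨Equiv.mulRight u, hr u⟩
  have := hstab h (by simp [h]) M hM (v * u⁻¹)
  simpa [h] using this

end

end SchurRing

/-! ### Products of simple quantities; passage to subgroups and quotients. -/

namespace SchurRing

variable {G : Type*} [Group G]

section Products

variable [Finite G]

theorem setSum_mul_of (X : Set G) (g : G) :
    setSum X * MonoidAlgebra.of ℤ G g = setSum {x | x * g⁻¹ ∈ X} := by
  classical
  apply setSum_eq_of_coeff <;> intro x hx <;>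
    rw [MonoidAlgebra.of_apply, MonoidAlgebra.coeff_mul_single_apply, mul_one, coeff_setSum]
  · exact if_pos hx
  · exact if_neg hx

theorem of_mul_setSum (X : Set G) (g : G) :
    MonoidAlgebra.of ℤ G g * setSum X = setSum {x | g⁻¹ * x ∈ X} := by
  classical
  apply setSum_eq_of_coeff <;> intro x hx <;>
    rw [MonoidAlgebra.of_apply, MonoidAlgebra.coeff_single_mul_apply, one_mul, coeff_setSum]
  · exact if_pos hx
  · exact if_neg hx

theorem setSum_eq_sum (X : Set G) :
    setSum X = ∑ x ∈ X.toFinite.toFinset, MonoidAlgebra.of ℤ G x :=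
  finsum_mem_eq_finite_toFinset_sum _ X.toFinite

theorem mul_setSum_eq {v w : MonoidAlgebra ℤ G} {X : Set G}
    (h : ∀ g ∈ X, v * MonoidAlgebra.of ℤ G g = w) : v * setSum X = (X.ncard : ℤ) • w := by
  rw [setSum_eq_sum, Finset.mul_sum, Finset.sum_congr rfl fun g hg => h g (by simpa using hg),
    Finset.sum_const, Set.ncard_eq_toFinset_card X, natCast_zsmul]

theorem setSum_mul_eq {v w : MonoidAlgebra ℤ G} {X : Set G}
    (h : ∀ g ∈ X, MonoidAlgebra.of ℤ G g * v = w) : setSum X * v = (X.ncard : ℤ) • w := by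
  rw [setSum_eq_sum, Finset.sum_mul, Finset.sum_congr rfl fun g hg => h g (by simpa using hg),
    Finset.sum_const, Set.ncard_eq_toFinset_card X, natCast_zsmul]

theorem setSum_univ_mul (X : Set G) :
    setSum Set.univ * setSum X = (X.ncard : ℤ) • setSum Set.univ :=
  mul_setSum_eq fun g _ => by rw [setSum_mul_of]; simp

theorem setSum_mul_univ (X : Set G) :
    setSum X * setSum Set.univ = (X.ncard : ℤ) • setSum Set.univ :=
  setSum_mul_eq fun g _ => by rw [of_mul_setSum]; simp

theorem coeff_setSum_mul (X Y : Set G) (z : G) :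
    (setSum X * setSum Y).coeff z = ({x | x ∈ X ∧ x⁻¹ * z ∈ Y}.ncard : ℤ) := by
  classical
  rw [setSum_eq_sum X, Finset.sum_mul, MonoidAlgebra.coeff_sum, Finsupp.finsetSum_apply,
    Set.ncard_eq_toFinset_card _ (Set.toFinite _), Finset.card_eq_sum_ones, Nat.cast_sum]
  have : (Set.toFinite {x | x ∈ X ∧ x⁻¹ * z ∈ Y}).toFinset =
      X.toFinite.toFinset.filter fun x => x⁻¹ * z ∈ Y := by
    ext x
    simp
  rw [this, Finset.sum_filter]
  refine Finset.sum_congr rfl fun x _ => ?_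
  rw [of_mul_setSum, coeff_setSum]
  simp

theorem map_setSum {H : Type*} [Group H] [Finite H] (φ : H →* G) (hφ : Function.Injective φ)
    (X : Set H) : MonoidAlgebra.mapDomainRingHom ℤ φ (setSum X) = setSum (φ '' X) := by
  classical
  rw [setSum_eq_sum, setSum_eq_sum, map_sum]
  have : (φ '' X).toFinite.toFinset = X.toFinite.toFinset.image φ := by
    ext x
    simp
  rw [this, Finset.sum_image fun x _ y _ h => hφ h]
  refine Finset.sum_congr rfl fun x _ => ?_
  simp [MonoidAlgebra.of_apply]

end Products

section Transfer

variable {H : Type*} [Group H]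

/-- The whole group is added only to cover `G`; it absorbs every simple quantity up to a scalar, so
the span remains a ring. -/
theorem IsSFamily.image_insert_univ [Finite G] (φ : H →* G) (hφ : Function.Injective φ)
    {F : Set (Set H)} (hF : IsSFamily F) : IsSFamily (insert Set.univ (Set.image φ '' F)) := by
  have : Finite H := Finite.of_injective φ hφ
  have hspan : ∀ w ∈ spanOf F,
      MonoidAlgebra.mapDomainRingHom ℤ φ w ∈ spanOf (insert Set.univ (Set.image φ '' F)) := by
    intro w hw
    induction hw using Submodule.span_induction with
    | mem w hw =>
      obtain ⟨M, hM, rfl⟩ := hw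
      rw [map_setSum φ hφ]
      exact setSum_mem_spanOf (Set.mem_insert_of_mem _ ⟨M, hM, rfl⟩)
    | zero => simp
    | add v w _ _ hv hw => rw [map_add]; exact Submodule.add_mem _ hv hw
    | smul a w _ hw => rw [map_zsmul]; exact Submodule.smul_mem _ a hw
  have huniv := setSum_mem_spanOf (Set.mem_insert (Set.univ : Set G) (Set.image φ '' F))
  constructor
  · exact Set.mem_insert_of_mem _ ⟨{1}, hF.one_mem, by simp⟩
  · exact fun x => ⟨Set.univ, Set.mem_insert _ _, Set.mem_univ x⟩
  · rintro M (rfl | ⟨M, hM, rfl⟩)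
    · exact Set.mem_insert _ _
    · refine Set.mem_insert_of_mem _ ⟨_, hF.inv_mem M hM, ?_⟩
      ext x
      constructor
      · rintro ⟨y, hy, rfl⟩
        exact ⟨y⁻¹, hy, map_inv φ y⟩
      · rintro ⟨y, hy, hxy⟩
        exact ⟨y⁻¹, by simpa using hy, by rw [map_inv, hxy, inv_inv]⟩
  · rintro M (rfl | ⟨M, hM, rfl⟩) N (rfl | ⟨N, hN, rfl⟩) hne
    · rw [Set.univ_inter]
      exact Set.mem_insert _ _
    · rw [Set.univ_inter]
      exact Set.mem_insert_of_mem _ ⟨N, hN, rfl⟩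
    · rw [Set.inter_univ]
      exact Set.mem_insert_of_mem _ ⟨M, hM, rfl⟩
    · rw [← Set.image_inter hφ] at hne ⊢
      exact Set.mem_insert_of_mem _ ⟨_, hF.inter_mem M hM N hN hne.of_image, rfl⟩
  · rintro M (rfl | ⟨M, hM, rfl⟩) N (rfl | ⟨N, hN, rfl⟩)
    · rw [setSum_univ_mul]
      exact Submodule.smul_mem _ _ huniv
    · rw [setSum_univ_mul]
      exact Submodule.smul_mem _ _ huniv
    · rw [setSum_mul_univ]
      exact Submodule.smul_mem _ _ huniv
    · rw [← map_setSum φ hφ, ← map_setSum φ hφ, ← map_mul]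
      exact hspan _ (hF.mul_mem M hM N hN)

theorem IsSchurFamilyGroup.of_injective [Finite G] (hG : IsSchurFamilyGroup G) (φ : H →* G)
    (hφ : Function.Injective φ) : IsSchurFamilyGroup H := by
  have : Finite H := Finite.of_injective φ hφ
  intro F hF x y hxy
  obtain ⟨f, hf1, hfx, hf⟩ := hG _ (hF.image_insert_univ φ hφ) (φ x) (φ y) (by
    rintro M (rfl | ⟨M, hM, rfl⟩)
    · simp
    · rw [hφ.mem_set_image, hφ.mem_set_image]
      exact hxy M hM)
  -- The image of each member is preserved relative to 1, so `f` maps the image of `H` into itself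
  -- and restricts to `H`.
  have hrange : ∀ h, ∃ h', φ h' = f (φ h) := by
    intro h
    obtain ⟨M, hM, hh⟩ := hF.cover h
    have := (hf _ (Set.mem_insert_of_mem _ ⟨M, hM, rfl⟩) 1 (φ h)).1
      (by simpa [hφ.mem_set_image] using hh)
    obtain ⟨h', -, hh'⟩ := this
    exact ⟨h', by simpa [hf1] using hh'⟩
  choose k hk using hrange
  have hinj : Function.Injective k := fun a b hab => hφ (f.injective (by rw [← hk, ← hk, hab]))
  refine ⟨Equiv.ofBijective k (Finite.injective_iff_bijective.1 hinj), ?_, ?_, ?_⟩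
  · exact hφ (by simp [hk, hf1])
  · exact hφ (by simp [hk, hfx])
  · intro M hM u v
    have := hf _ (Set.mem_insert_of_mem _ ⟨M, hM, rfl⟩) (φ u) (φ v)
    rw [← hk, ← hk, ← map_inv, ← map_inv, ← map_mul, ← map_mul, hφ.mem_set_image,
      hφ.mem_set_image] at this
    exact this

theorem ncard_preimage_of_surjective [Finite G] (π : G →* H) (hπ : Function.Surjective π)
    (X : Set H) : (π ⁻¹' X).ncard = Nat.card π.ker * X.ncard := by
  classical
  have : Finite H := Finite.of_surjective π hπ
  have hfib : ∀ q, (π ⁻¹' {q}).ncard = Nat.card π.ker := by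
    intro q
    obtain ⟨g, rfl⟩ := hπ q
    have : π ⁻¹' {π g} = (g * ·) '' (π.ker : Set G) := by
      ext x
      simp only [Set.mem_preimage, Set.mem_singleton_iff, Set.mem_image, SetLike.mem_coe,
        MonoidHom.mem_ker]
      exact ⟨fun h => ⟨g⁻¹ * x, by simp [h], by simp⟩, by rintro ⟨y, hy, rfl⟩; simp [hy]⟩
    rw [this, Set.ncard_image_of_injective _ (mul_right_injective g)]
    exact (Nat.card_coe_set_eq _).symm
  rw [Set.ncard_eq_toFinset_card _ (Set.toFinite (π ⁻¹' X)),
    Finset.card_eq_sum_card_fiberwise (f := π) (t := X.toFinite.toFinset)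
      (fun x hx => by simpa using hx),
    Finset.sum_congr rfl (g := fun _ => Nat.card π.ker), Finset.sum_const, smul_eq_mul, mul_comm,
    Set.ncard_eq_toFinset_card X]
  intro q hq
  rw [← hfib q, Set.ncard_eq_toFinset_card _ (Set.toFinite _)]
  congr 1
  ext x
  simp only [Finset.mem_filter, Set.Finite.mem_toFinset, Set.mem_preimage, Set.mem_singleton_iff,
    and_iff_right_iff_imp]
  rintro rfl
  simpa using hq

/-- Pulling back along `π` multiplies structure constants by the order of the kernel. The set `{1}`
has to be added because its preimage is the whole kernel. -/
theorem IsSFamily.insert_one_preimage [Finite G] (π : G →* H) (hπ : Function.Surjective π)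
    {F : Set (Set H)} (hF : IsSFamily F) : IsSFamily (insert {1} (Set.preimage π '' F)) := by
  classical
  have : Finite H := Finite.of_surjective π hπ
  have hspan : ∀ w ∈ spanOf F, ∃ v ∈ spanOf (insert {1} (Set.preimage π '' F)),
      ∀ x, v.coeff x = w.coeff (π x) := by
    intro w hw
    induction hw using Submodule.span_induction with
    | mem w hw =>
      obtain ⟨M, hM, rfl⟩ := hw
      refine ⟨_, setSum_mem_spanOf (Set.mem_insert_of_mem _ ⟨M, hM, rfl⟩), fun x => ?_⟩
      simp [coeff_setSum]
    | zero => exact ⟨0, Submodule.zero_mem _, fun x => rfl⟩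
    | add v w _ _ hv hw =>
      obtain ⟨v', hv', hv⟩ := hv
      obtain ⟨w', hw', hw⟩ := hw
      exact ⟨v' + w', Submodule.add_mem _ hv' hw', fun x => by simp [hv, hw]⟩
    | smul a w _ hw =>
      obtain ⟨w', hw', hw⟩ := hw
      exact ⟨a • w', Submodule.smul_mem _ a hw', fun x => by
        simp only [MonoidAlgebra.coeff_smul, Finsupp.smul_apply, hw]⟩
  have hone : setSum ({1} : Set G) = 1 := by rw [setSum_singleton, map_one]
  constructor
  · exact Set.mem_insert _ _
  · intro x
    obtain ⟨M, hM, hx⟩ := hF.cover (π x)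
    exact ⟨_, Set.mem_insert_of_mem _ ⟨M, hM, rfl⟩, hx⟩
  · rintro M (rfl | ⟨M, hM, rfl⟩)
    · left
      ext x
      simp
    · refine Set.mem_insert_of_mem _ ⟨_, hF.inv_mem M hM, ?_⟩
      ext x
      simp
  · have key : ∀ M : Set G, (({1} : Set G) ∩ M).Nonempty → ({1} : Set G) ∩ M = {1} := by
      rintro M ⟨x, hx, hxM⟩
      rw [Set.mem_singleton_iff] at hx
      subst hx
      exact Set.inter_eq_left.2 (Set.singleton_subset_iff.2 hxM)
    rintro M (rfl | ⟨M, hM, rfl⟩) N hN hne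
    · exact Or.inl (key N hne)
    · rcases hN with rfl | ⟨N, hN, rfl⟩
      · rw [Set.inter_comm] at hne ⊢
        exact Or.inl (key _ hne)
      · obtain ⟨x, hx⟩ := hne
        exact Set.mem_insert_of_mem _ ⟨_, hF.inter_mem M hM N hN ⟨π x, hx⟩, rfl⟩
  · rintro M hM' N hN'
    rcases hM' with rfl | ⟨M, hM, rfl⟩
    · rw [hone, one_mul]
      exact setSum_mem_spanOf hN'
    rcases hN' with rfl | ⟨N, hN, rfl⟩
    · rw [hone, mul_one]
      exact setSum_mem_spanOf (Set.mem_insert_of_mem _ ⟨M, hM, rfl⟩)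
    obtain ⟨v, hv, hvw⟩ := hspan _ (hF.mul_mem M hM N hN)
    have : setSum (π ⁻¹' M) * setSum (π ⁻¹' N) = (Nat.card π.ker : ℤ) • v := by
      ext z
      rw [coeff_setSum_mul, MonoidAlgebra.coeff_smul, Finsupp.smul_apply, hvw, coeff_setSum_mul,
        smul_eq_mul, ← Nat.cast_mul, ← ncard_preimage_of_surjective π hπ]
      congr 2
      ext x
      simp
    rw [this]
    exact Submodule.smul_mem _ _ hv

theorem IsSchurFamilyGroup.of_surjective [Finite G] (hG : IsSchurFamilyGroup G) (π : G →* H)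
    (hπ : Function.Surjective π) : IsSchurFamilyGroup H := by
  have : Finite H := Finite.of_surjective π hπ
  intro F hF x y hxy
  have hone := hxy _ hF.one_mem
  simp only [Set.mem_singleton_iff] at hone
  -- The added set `{1}` separates 1 from the rest of the kernel, so lifts of `x` and `y` are
  -- unseparated only away from 1.
  by_cases hx1 : x = 1
  · exact ⟨1, rfl, by rw [hx1, hone.1 hx1]; rfl, fun M _ u v => Iff.rfl⟩
  obtain ⟨x', rfl⟩ := hπ x
  obtain ⟨y', rfl⟩ := hπ y
  obtain ⟨f, hf1, hfx, hf⟩ := hG _ (hF.insert_one_preimage π hπ) x' y' (by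
    rintro M (rfl | ⟨M, hM, rfl⟩)
    · have hx : x' ≠ 1 := by
        rintro rfl
        exact hx1 (map_one π)
      have hy : y' ≠ 1 := by
        rintro rfl
        exact hx1 (hone.2 (map_one π))
      simp [hx, hy]
    · exact hxy M hM)
  replace hf : ∀ M ∈ F, ∀ u v, π (v * u⁻¹) ∈ M ↔ π (f v * (f u)⁻¹) ∈ M := fun M hM =>
    hf _ (Set.mem_insert_of_mem _ ⟨M, hM, rfl⟩)
  -- The kernel is itself a pulled-back member, so `f` permutes its cosets and descends to `H`.
  have hker : ∀ u v, π v = π u ↔ π (f v) = π (f u) := by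
    intro u v
    simpa [mul_inv_eq_one] using hf _ hF.one_mem u v
  choose s hs using hπ
  let k : H → H := fun q => π (f (s q))
  have hkπ : ∀ g, k (π g) = π (f g) := fun g => (hker _ _).1 (hs _)
  have hinj : Function.Injective k := fun a b hab => by
    have := (hker _ _).2 hab
    rwa [hs, hs] at this
  refine ⟨Equiv.ofBijective k (Finite.injective_iff_bijective.1 hinj), ?_, ?_, ?_⟩
  · have := hkπ 1
    rw [hf1, map_one] at this
    exact this
  · exact (hkπ x').trans (by rw [hfx])
  · intro M hM u v
    have := hf M hM (s u) (s v)
    simpa [hs] using this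

end Transfer

end SchurRing

/-! ### Rank-four S-rings and the two nonabelian groups of order 27. -/

namespace SchurRing

section PowZMod

variable {G : Type*} [Group G]

theorem pow_val_add {n : ℕ} [NeZero n] {g : G} (hg : g ^ n = 1) (s t : ZMod n) :
    g ^ (s + t).val = g ^ s.val * g ^ t.val := by
  rw [ZMod.val_add, ← pow_add, ← pow_eq_pow_mod _ hg]

theorem pow_val_mul {n : ℕ} [NeZero n] {g : G} (hg : g ^ n = 1) (s t : ZMod n) :
    g ^ (s * t).val = (g ^ s.val) ^ t.val := by
  rw [ZMod.val_mul, ← pow_mul, ← pow_eq_pow_mod _ hg]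

theorem pow_val_neg {n : ℕ} [NeZero n] {g : G} (hg : g ^ n = 1) (s : ZMod n) :
    g ^ (-s).val = (g ^ s.val)⁻¹ := by
  rw [eq_inv_iff_mul_eq_one, ← pow_val_add hg, neg_add_cancel, ZMod.val_zero, pow_zero]

end PowZMod

section RankFour

variable {K : Type*} [Group K] [Fintype K] [DecidableEq K]

/-- The color of the pair `(u, v)` in the Cayley scheme with basic sets `{1}`, `L \ {1}`, `X` and
the complement of `L ∪ X`. -/
def cayleyColor (L X : Finset K) (u v : K) : Fin 4 :=
  if v * u⁻¹ = 1 then 0 else if v * u⁻¹ ∈ L then 1 else if v * u⁻¹ ∈ X then 2 else 3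

/-- No color preserving extension of the partial map with graph `s` is defined on all of `ms`. -/
def NoExtension (L X : Finset K) : List K → List (K × K) → Bool
  | [], _ => false
  | m :: ms, s => decide (∀ w : K,
      (∀ r ∈ s, cayleyColor L X r.1 m = cayleyColor L X r.2 w) →
        NoExtension L X ms ((m, w) :: s) = true)

/-- A genuine colour-preserving map supplies, at every node of the search, a branch that survives:
send `m` to `f m`. -/
theorem noExtension_eq_false {L X : Finset K} {f : K → K}
    (hf : ∀ u v, cayleyColor L X u v = cayleyColor L X (f u) (f v)) (ms : List K)
    (s : List (K × K)) (hs : ∀ r ∈ s, f r.1 = r.2) : NoExtension L X ms s = false := by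
  induction ms generalizing s with
  | nil => rfl
  | cons m ms ih =>
    rw [NoExtension, decide_eq_false_iff_not]
    intro h
    have h1 := h (f m) fun r hr => by rw [← hs r hr]; exact hf _ _
    rw [ih _ fun r hr => ?_] at h1
    · exact Bool.false_ne_true h1
    · rcases List.mem_cons.1 hr with rfl | hr
      · rfl
      · exact hs r hr

/-- A partial difference set condition on the sets `L` and `X`. -/
structure IsAntipodalPair (L X : Finset K) : Prop where
  inv_left : ∀ x ∈ L, x⁻¹ ∈ L
  inv_right : ∀ x ∈ X, x⁻¹ ∈ X
  one_mem : 1 ∈ L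
  disjoint : Disjoint L X
  left_left : ∀ z, (L.filter fun x => x⁻¹ * z ∈ L).card = if z ∈ L then 3 else 0
  left_right : ∀ z, (L.filter fun x => x⁻¹ * z ∈ X).card = if z ∈ L then 0 else 1
  right_left : ∀ z, (X.filter fun x => x⁻¹ * z ∈ L).card = if z ∈ L then 0 else 1
  right_right : ∀ z, (X.filter fun x => x⁻¹ * z ∈ X).card =
    if z = 1 then 8 else if z ∈ L then 0 else if z ∈ X then 1 else 3

theorem coeff_setSum_mul_coe (L X : Finset K) (z : K) :
    (setSum (L : Set K) * setSum (X : Set K)).coeff z =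
      ((L.filter fun x => x⁻¹ * z ∈ X).card : ℤ) := by
  rw [coeff_setSum_mul, ← Set.ncard_coe_finset]
  congr 2
  ext x
  simp

/-- The numbers are those of a distance-regular antipodal 3-fold cover of the complete graph on 9
vertices: `X` gives adjacency and the cosets of the order-3 subgroup `L` are the fibres. Two
adjacent points have 1 common neighbour, and two points at distance 2 have 3. Thus X² = 8·1 + 3(G −
L) − 2X, while LX = XL = G − L. -/
theorem IsAntipodalPair.isSFamily {L X : Finset K} (h : IsAntipodalPair L X) :
    IsSFamily ({{1}, (L : Set K), (X : Set K), Set.univ} : Set (Set K)) := by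
  have hone : setSum ({1} : Set K) = 1 := by rw [setSum_singleton, map_one]
  have hLX : Disjoint (L : Set K) (X : Set K) := by exact_mod_cast h.disjoint
  have h1L : ({1} : Set K) ∩ L = {1} := by simpa using h.one_mem
  have h1X : Disjoint ({1} : Set K) X := hLX.mono_left (by simpa using h.one_mem)
  set F : Set (Set K) := {{1}, (L : Set K), (X : Set K), Set.univ} with hF
  have m1 : setSum ({1} : Set K) ∈ spanOf F := setSum_mem_spanOf (by simp [hF])
  have mL : setSum (L : Set K) ∈ spanOf F := setSum_mem_spanOf (by simp [hF])
  have mX : setSum (X : Set K) ∈ spanOf F := setSum_mem_spanOf (by simp [hF])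
  have mG : setSum (Set.univ : Set K) ∈ spanOf F := setSum_mem_spanOf (by simp [hF])
  have hLL : setSum (L : Set K) * setSum (L : Set K) = (3 : ℤ) • setSum (L : Set K) := by
    ext z
    rw [coeff_setSum_mul_coe, h.left_left, MonoidAlgebra.coeff_smul, Finsupp.smul_apply,
      coeff_setSum]
    simp only [Finset.mem_coe]
    split_ifs <;> simp
  have hLXp : setSum (L : Set K) * setSum (X : Set K) = setSum Set.univ - setSum (L : Set K) := by
    ext z
    rw [coeff_setSum_mul_coe, h.left_right, MonoidAlgebra.coeff_sub, Finsupp.sub_apply,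
      coeff_setSum, coeff_setSum]
    simp only [Finset.mem_coe, Set.mem_univ]
    split_ifs <;> simp
  have hXLp : setSum (X : Set K) * setSum (L : Set K) = setSum Set.univ - setSum (L : Set K) := by
    ext z
    rw [coeff_setSum_mul_coe, h.right_left, MonoidAlgebra.coeff_sub, Finsupp.sub_apply,
      coeff_setSum, coeff_setSum]
    simp only [Finset.mem_coe, Set.mem_univ]
    split_ifs <;> simp
  have hXX : setSum (X : Set K) * setSum (X : Set K) = (8 : ℤ) • setSum ({1} : Set K) +
      (3 : ℤ) • setSum Set.univ - (3 : ℤ) • setSum (L : Set K) -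
        (2 : ℤ) • setSum (X : Set K) := by
    ext z
    rw [coeff_setSum_mul_coe, h.right_right]
    simp only [MonoidAlgebra.coeff_sub, MonoidAlgebra.coeff_add, MonoidAlgebra.coeff_smul,
      Finsupp.sub_apply, Finsupp.add_apply, Finsupp.smul_apply, coeff_setSum, Finset.mem_coe,
      Set.mem_univ, Set.mem_singleton_iff]
    have hz : z = 1 → z ∈ L := by rintro rfl; exact h.one_mem
    have hz' : z ∈ L → z ∉ X := fun h1 h2 => Finset.disjoint_left.1 h.disjoint h1 h2
    split_ifs <;> simp_all
  constructor
  · simp [hF]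
  · exact fun x => ⟨Set.univ, by simp [hF], Set.mem_univ x⟩
  · have hL : {x : K | x⁻¹ ∈ (L : Set K)} = L := by
      ext x
      exact ⟨fun hx => by simpa using h.inv_left _ hx, h.inv_left x⟩
    have hX : {x : K | x⁻¹ ∈ (X : Set K)} = X := by
      ext x
      exact ⟨fun hx => by simpa using h.inv_right _ hx, h.inv_right x⟩
    rintro M (rfl | rfl | rfl | rfl)
    · left
      ext x
      simp
    · rw [hL]
      simp [hF]
    · rw [hX]
      simp [hF]
    · simp [hF]
  · rintro M (rfl | rfl | rfl | rfl) N (rfl | rfl | rfl | rfl) hne <;>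
      simp only [Set.inter_self, Set.inter_univ, Set.univ_inter, h1L, Set.inter_comm _ ({1} : Set K),
        h1X.inter_eq, hLX.inter_eq, hLX.symm.inter_eq, Set.not_nonempty_empty] at hne ⊢ <;>
      simp [hF]
  · have hG : ∀ Y : Set K, setSum Set.univ * setSum Y ∈ spanOf F := fun Y => by
      rw [setSum_univ_mul]
      exact Submodule.smul_mem _ _ mG
    have hG' : ∀ Y : Set K, setSum Y * setSum Set.univ ∈ spanOf F := fun Y => by
      rw [setSum_mul_univ]
      exact Submodule.smul_mem _ _ mG
    have h1 : ∀ N ∈ F, setSum ({1} : Set K) * setSum N ∈ spanOf F := fun N hN => by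
      rw [hone, one_mul]
      exact setSum_mem_spanOf hN
    have h1' : ∀ N ∈ F, setSum N * setSum ({1} : Set K) ∈ spanOf F := fun N hN => by
      rw [hone, mul_one]
      exact setSum_mem_spanOf hN
    have hLL' := hLL ▸ Submodule.smul_mem _ (3 : ℤ) mL
    have hLX' := hLXp ▸ Submodule.sub_mem _ mG mL
    have hXL' := hXLp ▸ Submodule.sub_mem _ mG mL
    have hXX' := hXX ▸ Submodule.sub_mem _ (Submodule.sub_mem _ (Submodule.add_mem _
      (Submodule.smul_mem _ (8 : ℤ) m1) (Submodule.smul_mem _ (3 : ℤ) mG))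
      (Submodule.smul_mem _ (3 : ℤ) mL)) (Submodule.smul_mem _ (2 : ℤ) mX)
    intro M hM N hN
    rcases hM with rfl | rfl | rfl | rfl
    · exact h1 N hN
    · rcases hN with rfl | rfl | rfl | rfl
      exacts [h1' _ (by simp [hF]), hLL', hLX', hG' _]
    · rcases hN with rfl | rfl | rfl | rfl
      exacts [h1' _ (by simp [hF]), hXL', hXX', hG' _]
    · exact hG _

/-- All points outside `L ∪ X` are mutually unseparated, so one pair that no automorphism exchanges
is enough. -/
theorem IsAntipodalPair.not_isSchurFamilyGroup {L X : Finset K} (h : IsAntipodalPair L X)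
    {x y : K} {ms : List K} (hx : x ∉ L ∧ x ∉ X) (hy : y ∉ L ∧ y ∉ X)
    (hms : NoExtension L X ms [(1, 1), (x, y)] = true) : ¬ IsSchurFamilyGroup K := by
  intro hK
  have hne : ∀ z : K, z ∉ L → z ≠ 1 := by
    rintro z hz rfl
    exact hz h.one_mem
  obtain ⟨f, hf1, hfx, hf⟩ := hK _ h.isSFamily x y (by
    rintro M (rfl | rfl | rfl | rfl)
    · simp [hne x hx.1, hne y hy.1]
    · simp [hx.1, hy.1]
    · simp [hx.2, hy.2]
    · simp)
  have hcol : ∀ u v, cayleyColor L X u v = cayleyColor L X (f u) (f v) := by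
    intro u v
    have e1 := hf {1} (by simp) u v
    have e2 := hf L (by simp) u v
    have e3 := hf X (by simp) u v
    simp only [Set.mem_singleton_iff, Finset.mem_coe] at e1 e2 e3
    simp only [cayleyColor, e1, e2, e3]
  rw [noExtension_eq_false hcol ms _ (by simp [hf1, hfx])] at hms
  exact Bool.false_ne_true hms

end RankFour

/-- The nonabelian group of order `27` on triples over `ZMod 3`; its exponent is `3` if `ε = 0`, and
`9` otherwise. -/
@[ext]
structure Ext27 (ε : ZMod 3) where
  fst : ZMod 3
  snd : ZMod 3
  thd : ZMod 3

namespace Ext27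

variable {ε : ZMod 3}

instance : Mul (Ext27 ε) :=
  ⟨fun x y => ⟨x.1 + y.1, x.2 + y.2,
    x.3 + y.3 + x.2 * y.1 + ε * (x.1 * x.1 * y.1 + x.1 * y.1 * y.1)⟩⟩

instance : One (Ext27 ε) := ⟨⟨0, 0, 0⟩⟩

instance : Inv (Ext27 ε) := ⟨fun x => ⟨-x.1, -x.2, -x.3 + x.2 * x.1⟩⟩

theorem mul_def (x y : Ext27 ε) : x * y = ⟨x.1 + y.1, x.2 + y.2,
    x.3 + y.3 + x.2 * y.1 + ε * (x.1 * x.1 * y.1 + x.1 * y.1 * y.1)⟩ := rfl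

theorem one_def : (1 : Ext27 ε) = ⟨0, 0, 0⟩ := rfl

theorem inv_def (x : Ext27 ε) : x⁻¹ = ⟨-x.1, -x.2, -x.3 + x.2 * x.1⟩ := rfl

instance : Group (Ext27 ε) := Group.ofLeftAxioms
  (fun x y z => by simp only [mul_def]; ext <;> ring)
  (fun x => by simp only [mul_def, one_def]; ext <;> ring)
  (fun x => by simp only [mul_def, one_def, inv_def]; ext <;> ring)

/-- The underlying triple. -/
def equivProd (ε : ZMod 3) : Ext27 ε ≃ ZMod 3 × ZMod 3 × ZMod 3 where
  toFun x := (x.1, x.2, x.3)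
  invFun x := ⟨x.1, x.2.1, x.2.2⟩

instance : DecidableEq (Ext27 ε) := (equivProd ε).decidableEq

instance : Fintype (Ext27 ε) := Fintype.ofEquiv _ (equivProd ε).symm

theorem not_isSchurFamilyGroup_zero : ¬ IsSchurFamilyGroup (Ext27 0) := by
  have h : IsAntipodalPair (K := Ext27 0) {⟨0, 0, 0⟩, ⟨1, 2, 1⟩, ⟨2, 1, 1⟩}
      {⟨0, 0, 1⟩, ⟨0, 0, 2⟩, ⟨0, 1, 2⟩, ⟨0, 2, 1⟩, ⟨1, 0, 2⟩, ⟨1, 1, 0⟩, ⟨2, 0, 1⟩, ⟨2, 2, 1⟩} := by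
    constructor <;> decide +kernel
  exact h.not_isSchurFamilyGroup (x := ⟨0, 1, 0⟩) (y := ⟨1, 2, 0⟩)
    -- Prescribing images of these four points already makes every branch of the search fail.
    (ms := [⟨1, 0, 1⟩, ⟨1, 1, 0⟩, ⟨0, 2, 2⟩, ⟨0, 0, 1⟩])
    (by decide +kernel) (by decide +kernel) (by decide +kernel)

theorem not_isSchurFamilyGroup_one : ¬ IsSchurFamilyGroup (Ext27 1) := by
  have h : IsAntipodalPair (K := Ext27 1) {⟨0, 0, 0⟩, ⟨0, 1, 2⟩, ⟨0, 2, 1⟩}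
      {⟨0, 0, 1⟩, ⟨0, 0, 2⟩, ⟨1, 0, 0⟩, ⟨1, 1, 1⟩, ⟨1, 2, 2⟩, ⟨2, 0, 0⟩, ⟨2, 1, 0⟩, ⟨2, 2, 0⟩} := by
    constructor <;> decide +kernel
  exact h.not_isSchurFamilyGroup (x := ⟨0, 1, 0⟩) (y := ⟨1, 0, 1⟩)
    (ms := [⟨0, 0, 1⟩, ⟨0, 0, 2⟩, ⟨0, 1, 1⟩, ⟨0, 1, 2⟩])
    (by decide +kernel) (by decide +kernel) (by decide +kernel)

end Ext27

end SchurRing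

/-! ### Recognizing the groups of order 27 by relations. -/

namespace SchurRing

namespace Ext27

variable {G : Type*} [Group G] {a b c : G}

/-- The transversal `1, a, a⁻¹` indexed by `ZMod 3`. -/
def signedPow (a : G) (i : ZMod 3) : G := if i = 0 then 1 else if i = 1 then a else a⁻¹

theorem _root_.ZMod.three_cases (i : ZMod 3) : i = 0 ∨ i = 1 ∨ i = 2 := by
  decide +revert

/-- The polynomial i²j + ij² is the carry cocycle of addition modulo 3 with digits 0, 1, −1. It is
nonzero only for 1 + 1 and 2 + 2, where a factor a³ or its inverse appears. -/
theorem signedPow_mul {ε : ZMod 3} (hc : c ^ 3 = 1)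
    (ha : a ^ 3 * c ^ ε.val = 1) (i j : ZMod 3) :
    signedPow a i * signedPow a j =
      signedPow a (i + j) * c ^ (ε * (i * i * j + i * j * j)).val := by
  have h1 : signedPow a 0 = 1 := rfl
  have h2 : signedPow a 1 = a := rfl
  have h3 : signedPow a 2 = a⁻¹ := rfl
  have ha3 : a ^ 3 = (c ^ ε.val)⁻¹ := eq_inv_of_mul_eq_one_left ha
  have e1 : c ^ (ε * 2).val = a ^ 3 := by
    rw [show ε * 2 = -ε by clear * -; decide +revert, pow_val_neg hc, ha3]
  have e2 : c ^ (ε * 1).val = (a ^ 3)⁻¹ := by rw [mul_one, ha3, inv_inv]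
  have e0 : c ^ (ε * 0).val = 1 := by rw [mul_zero, ZMod.val_zero, pow_zero]
  rcases i.three_cases with rfl | rfl | rfl <;> rcases j.three_cases with rfl | rfl | rfl
  · change signedPow a 0 * signedPow a 0 = signedPow a 0 * c ^ (ε * 0).val
    rw [e0, h1]
  · change signedPow a 0 * signedPow a 1 = signedPow a 1 * c ^ (ε * 0).val
    rw [e0, h1, mul_one, one_mul]
  · change signedPow a 0 * signedPow a 2 = signedPow a 2 * c ^ (ε * 0).val
    rw [e0, h1, mul_one, one_mul]
  · change signedPow a 1 * signedPow a 0 = signedPow a 1 * c ^ (ε * 0).val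
    rw [e0, h1]
  · change signedPow a 1 * signedPow a 1 = signedPow a 2 * c ^ (ε * 2).val
    rw [e1, h2, h3, pow_succ', inv_mul_cancel_left, sq]
  · change signedPow a 1 * signedPow a 2 = signedPow a 0 * c ^ (ε * 0).val
    rw [e0, h1, h2, h3, mul_inv_cancel, one_mul]
  · change signedPow a 2 * signedPow a 0 = signedPow a 2 * c ^ (ε * 0).val
    rw [e0, h1]
  · change signedPow a 2 * signedPow a 1 = signedPow a 0 * c ^ (ε * 0).val
    rw [e0, h1, h2, h3, inv_mul_cancel, one_mul]
  · change signedPow a 2 * signedPow a 2 = signedPow a 1 * c ^ (ε * 1).val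
    rw [e2, h2, h3]
    group

theorem pow_mul_signedPow (hc : c ^ 3 = 1) (hca : Commute c a) (hcb : Commute c b)
    (hba : b * a = a * b * c) (j i : ZMod 3) :
    b ^ j.val * signedPow a i = signedPow a i * b ^ j.val * c ^ (j * i).val := by
  have h1 : ∀ n : ℕ, b ^ n * a = a * b ^ n * c ^ n := by
    intro n
    induction n with
    | zero => simp
    | succ n ih =>
      rw [pow_succ b, mul_assoc, hba, ← mul_assoc, ← mul_assoc, ih, pow_succ c]
      simp only [mul_assoc]
      rw [← mul_assoc (c ^ n) b c, (hcb.pow_left n).eq, mul_assoc]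
  have h2 : ∀ n : ℕ, b ^ n * a⁻¹ = a⁻¹ * b ^ n * (c ^ n)⁻¹ := by
    intro n
    have := h1 n
    have hcn := hca.pow_left n
    rw [mul_inv_eq_iff_eq_mul, mul_assoc, mul_assoc, hcn.inv_left.eq, ← mul_assoc (b ^ n), h1]
    group
  rcases i.three_cases with rfl | rfl | rfl
  · simp [signedPow]
  · rw [mul_one]
    exact h1 _
  · rw [show j * 2 = -j by clear * -; decide +revert, pow_val_neg hc]
    exact h2 _

/-- The homomorphism from `Ext27 ε` to a group in which its defining relations hold. -/
def lift {ε : ZMod 3} (hc : c ^ 3 = 1) (hb : b ^ 3 = 1) (hca : Commute c a) (hcb : Commute c b)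
    (hba : b * a = a * b * c) (ha : a ^ 3 * c ^ ε.val = 1) : Ext27 ε →* G :=
  MonoidHom.mk' (fun x => signedPow a x.1 * b ^ x.2.val * c ^ x.3.val) (by
    rintro ⟨i, j, k⟩ ⟨i', j', k'⟩
    simp only [mul_def]
    have hcA : ∀ i, Commute c (signedPow a i) := by
      intro i
      unfold signedPow
      split_ifs
      exacts [Commute.one_right c, hca, hca.inv_right]
    have h1 := pow_mul_signedPow hc hca hcb hba j i'
    have h2 := signedPow_mul hc ha i i'
    rw [pow_val_add hb, pow_val_add hc, pow_val_add hc, pow_val_add hc]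
    generalize (ε * (i * i * i' + i * i' * i')).val = n at *
    generalize (j * i').val = m at *
    have hcb' : ∀ r s : ℕ, c ^ r * b ^ s = b ^ s * c ^ r := fun r s =>
      ((hcb.pow_left r).pow_right s).eq
    have hk := ((hcA i').pow_left k.val).eq
    symm
    calc _ = signedPow a i * (b ^ j.val * (c ^ k.val * signedPow a i')) * b ^ j'.val *
          c ^ k'.val := by simp only [mul_assoc]
      _ = signedPow a i * (b ^ j.val * signedPow a i') * (c ^ k.val * b ^ j'.val) *
          c ^ k'.val := by rw [hk]; simp only [mul_assoc]
      _ = (signedPow a i * signedPow a i') * b ^ j.val * (c ^ m * b ^ j'.val) * c ^ k.val *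
          c ^ k'.val := by rw [h1, hcb']; simp only [mul_assoc]
      _ = signedPow a (i + i') * (c ^ n * b ^ (j.val + j'.val)) * c ^ m * c ^ k.val *
          c ^ k'.val := by rw [h2, hcb', pow_add]; simp only [mul_assoc]
      _ = signedPow a (i + i') * b ^ (j.val + j'.val) * c ^ (n + m + k.val + k'.val) := by
          rw [hcb']
          simp only [pow_add, mul_assoc]
      _ = _ := by
          rw [pow_add b, show n + m + k.val + k'.val = k.val + k'.val + m + n by ring]
          simp only [pow_add, mul_assoc])

/-- If the exponent of `a` in a kernel element were nonzero, `a` would commute with `b`; likewise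
for the exponent of `b`. Since `c ≠ 1`, neither happens, and only a power of `c` is left. -/
theorem lift_injective {ε : ZMod 3} (hc : c ^ 3 = 1) (hb : b ^ 3 = 1) (hca : Commute c a)
    (hcb : Commute c b) (hba : b * a = a * b * c) (ha : a ^ 3 * c ^ ε.val = 1) (hc1 : c ≠ 1) :
    Function.Injective (lift hc hb hca hcb hba ha) := by
  have hab : ¬ Commute a b := fun h => hc1 (by rw [← h.eq] at hba; simpa using hba)
  rw [injective_iff_map_eq_one]
  rintro ⟨i, j, k⟩ h
  change signedPow a i * b ^ j.val * c ^ k.val = 1 at h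
  have hi : i = 0 := by
    have hA : signedPow a i = (b ^ j.val * c ^ k.val)⁻¹ := by
      rwa [eq_inv_iff_mul_eq_one, ← mul_assoc]
    have hA' : Commute (signedPow a i) b := by
      rw [hA]
      exact (((Commute.refl b).pow_left _).mul_left (hcb.pow_left _)).inv_left
    rcases i.three_cases with rfl | rfl | rfl
    · rfl
    · exact absurd hA' hab
    · exact absurd (by simpa using (show Commute a⁻¹ b from hA').inv_left) hab
  subst hi
  replace h : b ^ j.val * c ^ k.val = 1 := by simpa [signedPow] using h
  have hj : j = 0 := by
    have hB : Commute a (b ^ j.val) := by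
      rw [eq_inv_of_mul_eq_one_left h]
      exact ((hca.pow_left _).inv_left).symm
    rcases j.three_cases with rfl | rfl | rfl
    · rfl
    · exact absurd (by simpa using (show Commute a (b ^ 1) from hB)) hab
    · have h2 : Commute a (b ^ 2) := hB
      have : b = (b ^ 2) ^ 2 := by
        rw [← pow_mul, show 2 * 2 = 3 + 1 by rfl, pow_succ, hb, one_mul]
      rw [this] at hab
      exact absurd (h2.pow_right 2) hab
  subst hj
  replace h : c ^ k.val = 1 := by simpa using h
  have hk : k = 0 := by
    rcases k.three_cases with rfl | rfl | rfl
    · rfl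
    · exact absurd (by simpa using (show c ^ 1 = 1 from h)) hc1
    · have h2 : c ^ 2 = 1 := h
      rw [pow_succ, h2, one_mul] at hc
      exact absurd hc hc1
  subst hk
  rfl

end Ext27

theorem not_isSchurFamilyGroup_of_ext27 {G : Type*} [Group G] [Finite G] {a b c : G} {ε : ZMod 3}
    (hε : ε = 0 ∨ ε = 1) (hc : c ^ 3 = 1) (hb : b ^ 3 = 1) (hca : Commute c a)
    (hcb : Commute c b) (hba : b * a = a * b * c) (ha : a ^ 3 * c ^ ε.val = 1) (hc1 : c ≠ 1) :
    ¬ IsSchurFamilyGroup G := by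
  intro hG
  have := hG.of_injective _ (Ext27.lift_injective hc hb hca hcb hba ha hc1)
  rcases hε with rfl | rfl
  · exact Ext27.not_isSchurFamilyGroup_zero this
  · exact Ext27.not_isSchurFamilyGroup_one this

end SchurRing

/-! ### Groups of class two, and the primes greater than 3. -/

namespace SchurRing

variable {G : Type*} [Group G]

section SubgroupSums

variable [Finite G]

theorem setSum_mul_of_le {H K : Subgroup G} (h : H ≤ K) :
    setSum (H : Set G) * setSum (K : Set G) = ((H : Set G).ncard : ℤ) • setSum (K : Set G) := by
  refine setSum_mul_eq fun g hg => ?_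
  rw [of_mul_setSum]
  congr 1
  ext x
  exact K.mul_mem_cancel_left (K.inv_mem (h hg))

theorem setSum_mul_of_ge {H K : Subgroup G} (h : H ≤ K) :
    setSum (K : Set G) * setSum (H : Set G) = ((H : Set G).ncard : ℤ) • setSum (K : Set G) := by
  refine mul_setSum_eq fun g hg => ?_
  rw [setSum_mul_of]
  congr 1
  ext x
  exact K.mul_mem_cancel_right (K.inv_mem (h hg))

/-- All factorizations of z = xy in HK have the form (xv)(v⁻¹y) with v in the intersection, so each
z is counted equally often. -/
theorem setSum_mul_of_factorization {H K : Subgroup G}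
    (h : ∀ g, ∃ x ∈ H, ∃ y ∈ K, g = x * y) :
    setSum (H : Set G) * setSum (K : Set G) =
      (((H ⊓ K : Subgroup G) : Set G).ncard : ℤ) • setSum Set.univ := by
  classical
  ext z
  rw [coeff_setSum_mul, MonoidAlgebra.coeff_smul, Finsupp.smul_apply, coeff_setSum,
    if_pos (Set.mem_univ z), smul_eq_mul, mul_one]
  obtain ⟨x, hx, y, hy, rfl⟩ := h z
  rw [← Set.ncard_image_of_injective ((H ⊓ K : Subgroup G) : Set G) (mul_right_injective x)]
  congr 2
  ext w
  simp only [Set.mem_ofPred_eq, SetLike.mem_coe, Set.mem_image, Subgroup.mem_inf]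
  constructor
  · rintro ⟨h1, h2⟩
    refine ⟨x⁻¹ * w, ⟨H.mul_mem (H.inv_mem hx) h1, ?_⟩, by simp⟩
    have := K.mul_mem hy (K.inv_mem h2)
    simpa [mul_assoc] using this
  · rintro ⟨v, ⟨h1, h2⟩, rfl⟩
    refine ⟨H.mul_mem hx h1, ?_⟩
    have := K.mul_mem (K.inv_mem h2) hy
    simpa [mul_assoc] using this

theorem isSFamily_of_subgroups {T : Set (Subgroup G)} (hbot : ⊥ ∈ T) (htop : ⊤ ∈ T)
    (hinf : ∀ H ∈ T, ∀ K ∈ T, H ⊓ K ∈ T)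
    (hT : ∀ H ∈ T, ∀ K ∈ T, H ≤ K ∨ K ≤ H ∨ ∀ g, ∃ x ∈ H, ∃ y ∈ K, g = x * y) :
    IsSFamily ((fun H : Subgroup G => (H : Set G)) '' T) := by
  constructor
  · exact ⟨⊥, hbot, Subgroup.coe_bot⟩
  · exact fun x => ⟨_, ⟨⊤, htop, rfl⟩, Subgroup.mem_top x⟩
  · rintro _ ⟨H, hH, rfl⟩
    refine ⟨H, hH, ?_⟩
    ext x
    simp
  · rintro _ ⟨H, hH, rfl⟩ _ ⟨K, hK, rfl⟩ -
    exact ⟨_, hinf H hH K hK, Subgroup.coe_inf H K⟩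
  · rintro _ ⟨H, hH, rfl⟩ _ ⟨K, hK, rfl⟩
    rcases hT H hH K hK with h | h | h
    · simp only [setSum_mul_of_le h]
      exact Submodule.smul_mem _ _ (setSum_mem_spanOf ⟨K, hK, rfl⟩)
    · simp only [setSum_mul_of_ge h]
      exact Submodule.smul_mem _ _ (setSum_mem_spanOf ⟨H, hH, rfl⟩)
    · simp only [setSum_mul_of_factorization h]
      exact Submodule.smul_mem _ _ (setSum_mem_spanOf ⟨⊤, htop, Subgroup.coe_top⟩)

end SubgroupSums

section ClassTwo

open scoped commutatorElement

/-- The homomorphism `x ↦ ⁅x, w⁆` to the center of a group of nilpotency class at most two. -/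
def commHom (h : ∀ x y : G, ⁅x, y⁆ ∈ Subgroup.center G) (w : G) : G →* Subgroup.center G :=
  MonoidHom.mk' (fun x => ⟨⁅x, w⁆, h x w⟩) (by
    intro x y
    ext
    have := Subgroup.mem_center_iff.1 (h y w) x
    simp only [Subgroup.coe_mul, commutatorElement_def] at this ⊢
    calc x * y * w * (x * y)⁻¹ * w⁻¹ = (x * (y * w * y⁻¹ * w⁻¹)) * w * x⁻¹ * w⁻¹ := by group
      _ = _ := by
        rw [this]
        have h2 := Subgroup.mem_center_iff.1 (h y w) (x * w * x⁻¹ * w⁻¹)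
        rw [commutatorElement_def] at h2
        rw [h2]
        group)

variable {h : ∀ x y : G, ⁅x, y⁆ ∈ Subgroup.center G}

theorem coe_commHom (w x : G) : (commHom h w x : G) = ⁅x, w⁆ := rfl

theorem commHom_eq_one_iff {w x : G} : commHom h w x = 1 ↔ Commute x w := by
  rw [← commutatorElement_eq_one_iff_commute, ← coe_commHom (h := h), OneMemClass.coe_eq_one]

theorem commHom_swap (w x : G) : commHom h w x = (commHom h x w)⁻¹ := by
  ext
  rw [InvMemClass.coe_inv, coe_commHom, coe_commHom, commutatorElement_inv]

theorem commHom_mul (v w x : G) : commHom h (v * w) x = commHom h v x * commHom h w x := by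
  rw [commHom_swap, map_mul, mul_inv_rev, ← commHom_swap, ← commHom_swap]
  exact Subtype.ext (Subgroup.mem_center_iff.1 (commHom h v x).2 _)

/-- Central commutators allow the letters of any word in `x` and `y` to be sorted. -/
theorem exists_zpow_mul_zpow (h : ∀ x y : G, ⁅x, y⁆ ∈ Subgroup.center G) {x y : G}
    (hxy : Subgroup.closure {x, y} = ⊤) (g : G) :
    ∃ i j : ℤ, ∃ z ∈ Subgroup.center G, g = x ^ i * y ^ j * z := by
  have hg : g ∈ Subgroup.closure {x, y} := by
    rw [hxy]
    exact Subgroup.mem_top g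
  induction hg using Subgroup.closure_induction with
  | mem g hg =>
    rcases hg with rfl | rfl
    · exact ⟨1, 0, 1, one_mem _, by simp⟩
    · exact ⟨0, 1, 1, one_mem _, by simp⟩
  | one => exact ⟨0, 0, 1, one_mem _, by simp⟩
  | mul u v _ _ hu hv =>
    obtain ⟨i, j, z, hz, rfl⟩ := hu
    obtain ⟨k, l, w, hw, rfl⟩ := hv
    refine ⟨i + k, j + l, ⁅(y ^ j)⁻¹, (x ^ k)⁻¹⁆ * (z * w),
      mul_mem (h _ _) (mul_mem hz hw), ?_⟩
    have h1 := Subgroup.mem_center_iff.1 hz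
    have h2 := Subgroup.mem_center_iff.1 (h (y ^ j)⁻¹ (x ^ k)⁻¹)
    calc x ^ i * y ^ j * z * (x ^ k * y ^ l * w) = x ^ i * y ^ j * (z * (x ^ k * y ^ l)) * w := by
          simp only [mul_assoc]
      _ = x ^ i * (x ^ k * y ^ j * ⁅(y ^ j)⁻¹, (x ^ k)⁻¹⁆) * y ^ l * z * w := by
          rw [← h1, commutatorElement_def]
          group
      _ = x ^ i * x ^ k * y ^ j * (⁅(y ^ j)⁻¹, (x ^ k)⁻¹⁆ * y ^ l) * z * w := by
          simp only [mul_assoc]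
      _ = _ := by
          rw [← h2, zpow_add, zpow_add]
          simp only [mul_assoc]
  | inv u _ hu =>
    obtain ⟨i, j, z, hz, rfl⟩ := hu
    refine ⟨-i, -j, ⁅y ^ j, x ^ i⁆ * z⁻¹, mul_mem (h _ _) (inv_mem hz), ?_⟩
    have h1 := Subgroup.mem_center_iff.1 (inv_mem hz)
    rw [mul_inv_rev, ← h1, commutatorElement_def]
    group

/-- Sorting xyxyxy moves an x past a y three times, so exactly the cube of one central commutator
appears. -/
theorem cube_mul (h : ∀ x y : G, ⁅x, y⁆ ∈ Subgroup.center G) (h3 : ∀ x y : G, ⁅x, y⁆ ^ 3 = 1)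
    (x y : G) : (x * y) ^ 3 = x ^ 3 * y ^ 3 := by
  have h1 := h y⁻¹ x⁻¹
  have h2 := h3 y⁻¹ x⁻¹
  have h4 : y * x = x * y * ⁅y⁻¹, x⁻¹⁆ := by rw [commutatorElement_def]; group
  generalize ⁅y⁻¹, x⁻¹⁆ = d at *
  have hd : ∀ g, g * d = d * g := Subgroup.mem_center_iff.1 h1
  have h5 : ∀ g, g * (y * x) = d * (g * x * y) := fun g => by
    rw [h4, ← mul_assoc, hd, mul_assoc g]
  calc (x * y) ^ 3 = x * (y * x) * (y * x) * y := by
        rw [pow_succ, pow_two]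
        simp only [mul_assoc]
    _ = d * d * (x * x * (y * x) * y * y) := by
        rw [h5, h5]
        simp only [mul_assoc]
    _ = d * d * d * (x * x * x * y * y * y) := by
        rw [h5]
        simp only [mul_assoc]
    _ = d ^ 3 * (x ^ 3 * y ^ 3) := by simp only [pow_succ, pow_zero, one_mul, mul_assoc]
    _ = _ := by rw [h2, one_mul]

theorem three_pow_mul (h : ∀ x y : G, ⁅x, y⁆ ∈ Subgroup.center G)
    (h3 : ∀ x y : G, ⁅x, y⁆ ^ 3 = 1) (x y : G) (m : ℕ) :
    (x * y) ^ 3 ^ m = x ^ 3 ^ m * y ^ 3 ^ m := by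
  induction m with
  | zero => simp
  | succ m ih => rw [pow_succ, pow_mul, ih, cube_mul h h3, ← pow_mul, ← pow_mul]

end ClassTwo

section LargePrimes

open scoped commutatorElement

variable [Finite G]

/-- The kernel of `commHom h x` is the centralizer of x. Any two of the three centralizers used here
meet in the centre and have product G, so together with `⊥`, `⊤` and the centre they form an
S-family. -/
theorem not_isSchurFamilyGroup_of_not_commute_pow
    (h : ∀ x y : G, ⁅x, y⁆ ∈ Subgroup.center G)
    (hgen : ∀ x y : G, ¬ Commute x y → Subgroup.closure {x, y} = ⊤) {a b : G}
    (hab : ¬ Commute a b) (h2 : commHom h a b ^ 2 ≠ 1) (h3 : commHom h a b ^ 3 ≠ 1) :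
    ¬ IsSchurFamilyGroup G := by
  have hfac : ∀ x y : G, ¬ Commute x y →
      ∀ g, ∃ u ∈ (commHom h x).ker, ∃ v ∈ (commHom h y).ker, g = u * v := by
    intro x y hxy g
    obtain ⟨i, j, z, hz, rfl⟩ := exists_zpow_mul_zpow h (hgen x y hxy) g
    refine ⟨x ^ i, ?_, y ^ j * z, ?_, mul_assoc _ _ _⟩
    · exact commHom_eq_one_iff.2 ((Commute.refl x).zpow_left i)
    · exact commHom_eq_one_iff.2 (((Commute.refl y).zpow_left j).mul_left
        (Subgroup.mem_center_iff.1 hz y).symm)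
  have hinf : ∀ x y : G, ¬ Commute x y →
      (commHom h x).ker ⊓ (commHom h y).ker = Subgroup.center G := by
    intro x y hxy
    ext g
    rw [Subgroup.mem_inf, MonoidHom.mem_ker, MonoidHom.mem_ker, commHom_eq_one_iff,
      commHom_eq_one_iff, Subgroup.mem_center_iff]
    refine ⟨fun hg k => ?_, fun hg => ⟨(hg x).symm, (hg y).symm⟩⟩
    obtain ⟨i, j, z, hz, rfl⟩ := exists_zpow_mul_zpow h (hgen x y hxy) k
    exact (((hg.1.zpow_right i).mul_right (hg.2.zpow_right j)).mul_right
      (Subgroup.mem_center_iff.1 hz g)).eq.symm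
  have hker : ∀ x, Subgroup.center G ≤ (commHom h x).ker := fun x g hg =>
    commHom_eq_one_iff.2 (Subgroup.mem_center_iff.1 hg x).symm
  have hba : ¬ Commute b a := fun hc => hab hc.symm
  have haab : ¬ Commute a (a * b) := fun hc => hab (by
    simpa using (Commute.refl a).inv_right.mul_right hc)
  have hbab : ¬ Commute b (a * b) := fun hc => hba (by
    simpa using hc.mul_right (Commute.refl b).inv_right)
  have haab' : ¬ Commute (a * b) a := fun hc => haab hc.symm
  have hbab' : ¬ Commute (a * b) b := fun hc => hbab hc.symm
  set T : Set (Subgroup G) := {⊥, ⊤, Subgroup.center G, (commHom h a).ker, (commHom h b).ker,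
    (commHom h (a * b)).ker} with hT
  have hF : IsSFamily ((fun H : Subgroup G => (H : Set G)) '' T) := by
    refine isSFamily_of_subgroups (by simp [hT]) (by simp [hT]) ?_ ?_
    · rintro H (rfl | rfl | rfl | rfl | rfl | rfl) K (rfl | rfl | rfl | rfl | rfl | rfl) <;>
        simp only [bot_inf_eq, inf_bot_eq, top_inf_eq, inf_top_eq, inf_idem, hinf _ _ hab,
          hinf _ _ hba, hinf _ _ haab, hinf _ _ hbab, hinf _ _ haab', hinf _ _ hbab',
          inf_eq_left.2 (hker _), inf_eq_right.2 (hker _)] <;> simp [hT]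
    · rintro H (rfl | rfl | rfl | rfl | rfl | rfl) K (rfl | rfl | rfl | rfl | rfl | rfl) <;>
        first
        | with_reducible exact Or.inl bot_le
        | with_reducible exact Or.inl le_top
        | with_reducible exact Or.inl le_rfl
        | with_reducible exact Or.inr (Or.inl bot_le)
        | with_reducible exact Or.inr (Or.inl le_top)
        | with_reducible exact Or.inl (hker _)
        | with_reducible exact Or.inr (Or.inl (hker _))
        | with_reducible exact Or.inr (Or.inr (hfac _ _ (by assumption)))
  intro hG
  set α := commHom h a with hα
  set β := commHom h b with hβ
  have hαa : α a = 1 := commHom_eq_one_iff.2 (Commute.refl a)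
  have hβb : β b = 1 := commHom_eq_one_iff.2 (Commute.refl b)
  have hβa : β a = (α b)⁻¹ := commHom_swap b a
  have hαβ : ∀ g, commHom h (a * b) g = α g * β g := commHom_mul a b
  have hα1 : α b ≠ 1 := fun hc => hba (commHom_eq_one_iff.1 hc)
  -- On ab^n the three homomorphisms take the values γ^n, γ⁻¹ and γ^(n−1), where γ = `α b`. If none
  -- of them is 1, then ab^n lies in no proper member; n = 2 and n = 3 both qualify.
  have hns : ∀ n : ℕ, α b ^ n ≠ 1 → α b ^ (n - 1 : ℤ) ≠ 1 → ∀ H ∈ T, a * b ^ n ∈ H ↔ H = ⊤ := by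
    intro n hn hn1 H hH
    refine ⟨fun hg => ?_, fun hH => hH ▸ Subgroup.mem_top _⟩
    have ea : α (a * b ^ n) = α b ^ n := by rw [map_mul, map_pow, hαa, one_mul]
    have eb : β (a * b ^ n) = (α b)⁻¹ := by rw [map_mul, map_pow, hβb, one_pow, mul_one, hβa]
    rcases hH with rfl | rfl | rfl | rfl | rfl | rfl
    · rw [Subgroup.mem_bot.1 hg, map_one] at eb
      exact absurd (inv_eq_one.1 eb.symm) hα1
    · rfl
    · exact absurd (ea ▸ hker a hg) hn
    · exact absurd (ea ▸ hg) hn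
    · rw [MonoidHom.mem_ker, eb, inv_eq_one] at hg
      exact absurd hg hα1
    · rw [MonoidHom.mem_ker, hαβ, ea, eb, ← zpow_natCast, ← zpow_sub_one] at hg
      exact absurd hg hn1
  obtain ⟨f, hf1, hfx, hf⟩ := hG _ hF (a * b ^ 2) (a * b ^ 3) (by
    rintro _ ⟨H, hH, rfl⟩
    refine (hns 2 h2 ?_ H hH).trans (hns 3 h3 ?_ H hH).symm
    · norm_num
      exact hα1
    · norm_num
      exact_mod_cast h2)
  -- `f` respects each of the three partitions into cosets of a centralizer.
  have hrel : ∀ x ∈ ({a, b, a * b} : Set G), ∀ u v, commHom h x u = commHom h x v →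
      commHom h x (f u) = commHom h x (f v) := by
    intro x hx u v huv
    have := hf ((commHom h x).ker : Set G) ⟨(commHom h x).ker, by
      rcases hx with rfl | rfl | rfl <;> simp [hT, hα, hβ], rfl⟩ v u
    simp only [SetLike.mem_coe, MonoidHom.mem_ker, map_mul, map_inv, mul_inv_eq_one] at this
    exact this.1 huv
  -- Lines through 1, b, ab and ab² are followed. With f(1) = 1 and f(ab²) = ab³ they force α(f(ab))
  -- = α(f(b)) = γ, whereas the line through b and ab² demands γ², so γ = 1.
  have r1 := hrel (a * b) (by simp) (a * b) 1
    (by rw [map_one]; exact commHom_eq_one_iff.2 (Commute.refl _))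
  have r2 := hrel b (by simp) (a * b) (a * b ^ 2) (by simp [← hβ, hβb])
  have r3 := hrel b (by simp) b 1 (by simp [← hβ, hβb])
  have r4 := hrel a (by simp) b (a * b) (by simp [← hα, hαa])
  have r5 := hrel (a * b) (by simp) b (a * b ^ 2) (by
    rw [hαβ, hαβ]
    simp [hβb, hαa, hβa, pow_two])
  rw [← hα] at r4
  rw [← hβ] at r2 r3
  rw [hαβ, hαβ, hf1, map_one, map_one, mul_one] at r1
  rw [hαβ, hαβ] at r5
  simp only [hfx, hf1, map_mul, map_pow, hβb, hβa, hαa, map_one, one_pow, one_mul, mul_one] at *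
  rw [r2, mul_inv_eq_one] at r1
  rw [r4, r3, mul_one, r1] at r5
  refine hα1 ?_
  have : α b ^ 3 * (α b)⁻¹ = α b * α b := by rw [pow_succ, mul_inv_cancel_right, pow_two]
  rw [this] at r5
  exact left_eq_mul.1 r5

end LargePrimes

end SchurRing

/-! ### Coordinates on a modular 3-group. -/

namespace SchurRing

variable {G : Type*} [Group G]

theorem zpow_eq_pow_val {n : ℕ} [NeZero n] {g : G} (hg : g ^ n = 1) (k : ℤ) :
    g ^ k = g ^ (k : ZMod n).val := by
  rw [← zpow_natCast, ZMod.val_intCast, ← zpow_eq_zpow_emod' k hg]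

/-- Generators `a`, `b` of a modular `3`-group of order `27 * q`, with `c = ⁅a, b⁆ = a ^ (3 * q)`. -/
structure IsModularPair (q : ℕ) (a b c : G) : Prop where
  three_dvd : 3 ∣ q
  odd : Odd q
  pow_b : b ^ 3 = 1
  pow_c : c ^ 3 = 1
  comm_cb : Commute c b
  comm_ca : Commute c a
  rel : a * b = b * c * a
  pow_a : a ^ (3 * q) = c
  order_a : ∀ i : ℤ, a ^ i = 1 → (9 * q : ℤ) ∣ i
  exists_eq : ∀ g : G, ∃ (n : ℕ) (i : ℤ), g = b ^ n * a ^ i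

namespace IsModularPair

variable {q : ℕ} {a b c : G}

/-- The element with coordinates `i`, `s`, `t`. -/
def elt (a b c : G) (i : ℤ) (s t : ZMod 3) : G := b ^ s.val * c ^ t.val * a ^ i

section Coordinates

variable (h : IsModularPair q a b c)
include h

theorem q_pos : 0 < q := h.odd.pos

theorem cast_q : (q : ZMod 3) = 0 := (ZMod.natCast_eq_zero_iff q 3).2 h.three_dvd

/-- Conjugation by `a` multiplies `b` by `c` and fixes `c`. -/
theorem zpow_mul_pow (i : ℤ) (s : ZMod 3) :
    a ^ i * b ^ s.val = b ^ s.val * c ^ ((i : ZMod 3) * s).val * a ^ i := by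
  have h1 : ∀ i : ℤ, a ^ i * b * (a ^ i)⁻¹ = b * c ^ i := by
    intro i
    induction i using Int.induction_on with
    | zero => simp
    | succ n ih =>
      have h2 : a ^ (n : ℤ) * c = c * a ^ (n : ℤ) := (h.comm_ca.zpow_right n).symm
      calc a ^ ((n : ℤ) + 1) * b * (a ^ ((n : ℤ) + 1))⁻¹
          = a ^ (n : ℤ) * (a * b) * a⁻¹ * (a ^ (n : ℤ))⁻¹ := by
            rw [zpow_add_one, mul_inv_rev]
            simp only [mul_assoc]
        _ = a ^ (n : ℤ) * b * c * (a ^ (n : ℤ))⁻¹ := by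
            rw [h.rel]
            group
        _ = a ^ (n : ℤ) * b * (a ^ (n : ℤ))⁻¹ * c := by
            rw [mul_assoc _ c, (h.comm_ca.zpow_right n).inv_right.eq, ← mul_assoc]
        _ = b * c ^ ((n : ℤ) + 1) := by rw [ih, mul_assoc, zpow_add_one]
    | pred n ih =>
      have h2 : a⁻¹ * b * a = b * c⁻¹ := by
        have h3 : a⁻¹ * b * c = b * a⁻¹ := by
          rw [mul_assoc, inv_mul_eq_iff_eq_mul, ← mul_assoc, h.rel, mul_inv_cancel_right]
        calc a⁻¹ * b * a = a⁻¹ * b * c * (c⁻¹ * a) := by group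
          _ = _ := by
            rw [h3, h.comm_ca.inv_left.eq]
            group
      calc a ^ (-(n : ℤ) - 1) * b * (a ^ (-(n : ℤ) - 1))⁻¹
          = a ^ (-(n : ℤ)) * (a⁻¹ * b * a) * (a ^ (-(n : ℤ)))⁻¹ := by
            rw [zpow_sub_one, mul_inv_rev, inv_inv]
            simp only [mul_assoc]
        _ = a ^ (-(n : ℤ)) * b * (a ^ (-(n : ℤ)))⁻¹ * c⁻¹ := by
            rw [h2, ← mul_assoc, mul_assoc _ c⁻¹,
              ((h.comm_ca.zpow_right (-(n : ℤ))).inv_right).inv_left.eq, ← mul_assoc]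
        _ = b * c ^ (-(n : ℤ) - 1) := by rw [ih, mul_assoc, zpow_sub_one]
  have h2 : a ^ i * b ^ s.val * (a ^ i)⁻¹ = b ^ s.val * c ^ ((i : ZMod 3) * s).val := by
    rw [← conj_pow, h1, (h.comm_cb.zpow_left i).symm.mul_pow, pow_val_mul h.pow_c,
      zpow_eq_pow_val h.pow_c]
  rw [← h2, inv_mul_cancel_right]

theorem elt_mul (i i' : ℤ) (s t s' t' : ZMod 3) :
    elt a b c i s t * elt a b c i' s' t' =
      elt a b c (i + i') (s + s') (t + t' + i * s') := by
  have hcb : ∀ r s : ℕ, c ^ r * b ^ s = b ^ s * c ^ r := fun r s =>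
    ((h.comm_cb.pow_left r).pow_right s).eq
  have hca : ∀ (r : ℕ) (i : ℤ), a ^ i * c ^ r = c ^ r * a ^ i := fun r i =>
    ((h.comm_ca.pow_left r).zpow_right i).eq.symm
  unfold elt
  rw [pow_val_add h.pow_b, pow_val_add h.pow_c, pow_val_add h.pow_c, zpow_add]
  have h1 := h.zpow_mul_pow i s'
  generalize ((i : ZMod 3) * s').val = n at *
  calc b ^ s.val * c ^ t.val * a ^ i * (b ^ s'.val * c ^ t'.val * a ^ i')
      = b ^ s.val * c ^ t.val * (a ^ i * b ^ s'.val) * c ^ t'.val * a ^ i' := by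
        simp only [mul_assoc]
    _ = b ^ s.val * (c ^ t.val * b ^ s'.val) * c ^ n * (a ^ i * c ^ t'.val) * a ^ i' := by
        rw [h1]
        simp only [mul_assoc]
    _ = b ^ s.val * b ^ s'.val * c ^ t.val * (c ^ n * c ^ t'.val) * (a ^ i * a ^ i') := by
        rw [hca, hcb]
        simp only [mul_assoc]
    _ = _ := by
        rw [← pow_add c n, add_comm n, pow_add c]
        simp only [mul_assoc]

omit h in
theorem elt_zero : elt a b c 0 0 0 = 1 := by simp [elt]

theorem elt_inv (i : ℤ) (s t : ZMod 3) :
    (elt a b c i s t)⁻¹ = elt a b c (-i) (-s) (-t + i * s) := by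
  rw [inv_eq_iff_mul_eq_one, h.elt_mul, ← elt_zero (a := a) (b := b) (c := c)]
  congr 1 <;> ring

theorem elt_mul_inv (i i' : ℤ) (s t s' t' : ZMod 3) :
    elt a b c i' s' t' * (elt a b c i s t)⁻¹ =
      elt a b c (i' - i) (s' - s) (t' - t - ((i' - i : ℤ) : ZMod 3) * s) := by
  rw [h.elt_inv, h.elt_mul]
  congr 1 <;>
  · push_cast
    ring

/-- The integer coordinate is redundant: since `c` is the power a^(3q), going once around the levels
shifts the third coordinate by one. This twist is what finally rules out an automorphism. -/
theorem elt_add (i m : ℤ) (s t : ZMod 3) :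
    elt a b c (i + 3 * q * m) s t = elt a b c i s (t + m) := by
  have h1 : a ^ (3 * (q : ℤ) * m) = c ^ (m : ZMod 3).val := by
    rw [zpow_mul, ← zpow_eq_pow_val h.pow_c, ← h.pow_a]
    norm_cast
  unfold elt
  rw [add_comm i, zpow_add, h1, pow_val_add h.pow_c]
  simp only [mul_assoc]

theorem exists_elt (g : G) : ∃ i s t, g = elt a b c i s t := by
  obtain ⟨n, i, rfl⟩ := h.exists_eq g
  refine ⟨i, (n : ZMod 3), 0, ?_⟩
  rw [elt, ZMod.val_zero, pow_zero, mul_one, ZMod.val_natCast, ← pow_eq_pow_mod n h.pow_b]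

theorem c_ne_one : c ≠ 1 := by
  intro hc
  have h1 := h.order_a (3 * q) (by
    have := h.pow_a
    rw [hc] at this
    exact_mod_cast this)
  have h2 := h.q_pos
  have := Int.le_of_dvd (by omega) h1
  omega

/-- If `s` were nonzero, commuting with `a` would make `c` trivial; what remains is a power of `a`,
controlled by its order. -/
theorem elt_eq_one {i : ℤ} {s t : ZMod 3} (he : elt a b c i s t = 1) :
    s = 0 ∧ (3 * q : ℤ) ∣ i ∧ (i = 0 → t = 0) := by
  have hs : s = 0 := by
    have h1 : elt a b c 1 0 0 * elt a b c i s t = elt a b c i s t * elt a b c 1 0 0 := by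
      rw [he, one_mul, mul_one]
    rw [h.elt_mul, h.elt_mul, add_comm i 1] at h1
    simp only [Int.cast_one, one_mul, zero_add, add_zero, mul_zero, elt] at h1
    have h2 := mul_left_cancel (mul_right_cancel h1)
    rw [pow_val_add h.pow_c, mul_eq_left] at h2
    rcases s.three_cases with rfl | rfl | rfl
    · rfl
    · exact absurd (by simpa using (show c ^ 1 = 1 from h2)) h.c_ne_one
    · have h3 := h.pow_c
      rw [pow_succ, show c ^ 2 = 1 from h2, one_mul] at h3
      exact absurd h3 h.c_ne_one
  subst hs
  have h1 : a ^ (i + 3 * q * t.val) = 1 := by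
    rw [← he, elt, ZMod.val_zero, pow_zero, one_mul, ← h.pow_a, add_comm, zpow_add]
    congr 1
    rw [← pow_mul]
    norm_cast
  obtain ⟨k, hk⟩ := h.order_a _ h1
  refine ⟨rfl, ⟨3 * k - t.val, by linear_combination hk⟩, ?_⟩
  rintro rfl
  have hq := h.q_pos
  have h2 : (t.val : ℤ) = 3 * k := by
    have : (3 * q : ℤ) * t.val = 3 * q * (3 * k) := by linear_combination hk
    exact mul_left_cancel₀ (by positivity) this
  have h3 := ZMod.val_lt t
  exact (ZMod.val_eq_zero t).1 (by omega)

theorem elt_inj {i i' : ℤ} {s t s' t' : ZMod 3} (he : elt a b c i s t = elt a b c i' s' t') :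
    s = s' ∧ (3 * q : ℤ) ∣ i - i' ∧ (i = i' → t = t') := by
  have h1 : elt a b c i s t * (elt a b c i' s' t')⁻¹ = 1 := by rw [he, mul_inv_cancel]
  rw [h.elt_mul_inv] at h1
  obtain ⟨h2, h3, h4⟩ := h.elt_eq_one h1
  refine ⟨sub_eq_zero.1 h2, h3, ?_⟩
  rintro rfl
  simpa [sub_eq_zero] using h4 (sub_self i)

/-- The exponent of `a`, modulo `3 * q`. -/
theorem exists_level : ∃ κ : G → ZMod (3 * q), (∀ i s t, κ (elt a b c i s t) = i) ∧
    ∀ x y, κ (x * y⁻¹) = κ x - κ y := by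
  choose i s t hist using h.exists_elt
  have key : ∀ i' s' t', ((i (elt a b c i' s' t') : ℤ) : ZMod (3 * q)) = i' := by
    intro i' s' t'
    have := (h.elt_inj (hist (elt a b c i' s' t'))).2.1
    rw [ZMod.intCast_eq_intCast_iff_dvd_sub]
    exact_mod_cast this
  refine ⟨fun g => (i g : ZMod (3 * q)), key, fun x y => ?_⟩
  have h1 := key (i x - i y) (s x - s y) (t x - t y - ((i x - i y : ℤ) : ZMod 3) * s y)
  rw [← h.elt_mul_inv, ← hist, ← hist] at h1
  simpa using h1

end Coordinates

/-- The exponent of `a`, modulo `3 * q`. -/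
noncomputable def level (h : IsModularPair q a b c) : G → ZMod (3 * q) := h.exists_level.choose

section Level

variable (h : IsModularPair q a b c)
include h

theorem level_elt (i : ℤ) (s t : ZMod 3) : h.level (elt a b c i s t) = i :=
  h.exists_level.choose_spec.1 i s t

theorem level_mul_inv (x y : G) : h.level (x * y⁻¹) = h.level x - h.level y :=
  h.exists_level.choose_spec.2 x y

theorem level_one : h.level 1 = 0 := by
  rw [← elt_zero (a := a) (b := b) (c := c), level_elt, Int.cast_zero]

theorem level_inv (x : G) : h.level x⁻¹ = -h.level x := by
  have := h.level_mul_inv 1 x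
  rwa [one_mul, level_one, zero_sub] at this

theorem exists_elt_of_level {x : G} {i : ℤ} (hx : h.level x = i) :
    ∃ s t, x = elt a b c i s t := by
  obtain ⟨i', s, t, rfl⟩ := h.exists_elt x
  rw [level_elt, ZMod.intCast_eq_intCast_iff_dvd_sub] at hx
  obtain ⟨m, hm⟩ := hx
  refine ⟨s, t - m, ?_⟩
  have : i = i' + 3 * q * m := by push_cast at hm; linear_combination hm
  rw [this, h.elt_add, sub_add_cancel]

/-- Since 3q is odd, 2 is invertible; hence opposite nonzero levels are distinct, and sign
ambiguities can be resolved. -/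
theorem two_ne_zero_level {k : ZMod (3 * q)} (hk : 2 * k = 0) : k = 0 := by
  have hc : Nat.Coprime 2 (3 * q) :=
    (Nat.coprime_two_left).2 ((by decide : Odd 3).mul h.odd)
  have hu : IsUnit ((2 : ℕ) : ZMod (3 * q)) := (ZMod.isUnit_iff_coprime 2 (3 * q)).2 hc
  exact hu.mul_right_eq_zero.1 (by exact_mod_cast hk)

theorem one_ne_zero_level : (1 : ZMod (3 * q)) ≠ 0 := by
  have hq := h.q_pos
  have : Fact (1 < 3 * q) := ⟨by omega⟩
  exact one_ne_zero

theorem q_ne_zero_level : (q : ZMod (3 * q)) ≠ 0 := by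
  have hq := h.q_pos
  rw [Ne, ZMod.natCast_eq_zero_iff]
  intro hd
  have := Nat.le_of_dvd hq hd
  omega

theorem q_ne_one_level : (q : ZMod (3 * q)) ≠ 1 := by
  intro hq
  have h1 : ((q : ℤ) : ZMod (3 * q)) = (1 : ℤ) := by exact_mod_cast hq
  rw [ZMod.intCast_eq_intCast_iff_dvd_sub] at h1
  obtain ⟨m, hm⟩ := h1
  obtain ⟨r, hr⟩ := h.three_dvd
  rw [hr] at hm
  push_cast at hm
  have : (3 : ℤ) * (r + 3 * r * m) = 1 := by linear_combination -hm
  omega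

theorem q_ne_neg_one_level : (q : ZMod (3 * q)) ≠ -1 := by
  intro hq
  have h1 : ((q : ℤ) : ZMod (3 * q)) = (-1 : ℤ) := by exact_mod_cast hq
  rw [ZMod.intCast_eq_intCast_iff_dvd_sub] at h1
  obtain ⟨m, hm⟩ := h1
  obtain ⟨r, hr⟩ := h.three_dvd
  rw [hr] at hm
  push_cast at hm
  have : (3 : ℤ) * (r + 3 * r * m) = -1 := by linear_combination -hm
  omega

theorem ne_neg_self_level {k : ZMod (3 * q)} (hk : k ≠ 0) : k ≠ -k := fun hc =>
  hk (h.two_ne_zero_level (by linear_combination hc))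

end Level

end IsModularPair

end SchurRing

/-! ### Calculus of lines and planes. -/

namespace SchurRing

variable {G : Type*} [Group G]

namespace IsModularPair

variable {q : ℕ} {a b c : G}

section Sets

variable (a b c)

/-- The set of elements with coordinates `i`, `s`, `j + l * s`. -/
def line (i : ℤ) (l j : ZMod 3) : Set G := Set.range fun s => elt a b c i s (j + l * s)

/-- The set of elements with first coordinate `i`. -/
def plane (i : ℤ) : Set G := Set.range fun r : ZMod 3 × ZMod 3 => elt a b c i r.1 r.2

/-- The subgroup generated by `c`. -/
def vert : Set G := Set.range fun t => elt a b c 0 0 t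

/-- Two opposite lines over the levels `q` and `-q`. -/
def skewPair (q : ℕ) (j : ZMod 3) : Set G := line a b c q (-1) j ∪ line a b c (-q) (-1) (-j)

/-- The union of the coset `a * ⟨b⟩` and its inverse. -/
def cross : Set G := line a b c 1 1 0 ∪ line a b c (-1) 0 0

/-- Two opposite planes. -/
def planePair (k : ℤ) : Set G := plane a b c k ∪ plane a b c (-k)

/-- An `S`-family over a modular `3`-group. -/
def family (q : ℕ) : Set (Set G) :=
  {{1}, vert a b c, line a b c 0 (-1) 0, cross a b c} ∪ Set.range (skewPair a b c q) ∪
    Set.range (planePair a b c)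

end Sets

theorem _root_.SchurRing.setSum_range {ι : Type*} [Fintype ι] {f : ι → G}
    (hf : Function.Injective f) : setSum (Set.range f) = ∑ i, MonoidAlgebra.of ℤ G (f i) := by
  rw [setSum, finsum_mem_range hf, finsum_eq_sum_of_fintype]

theorem line_subset_plane (i : ℤ) (l j : ZMod 3) : line a b c i l j ⊆ plane a b c i := by
  rintro _ ⟨s, rfl⟩
  exact ⟨(s, _), rfl⟩

section Sums

variable (h : IsModularPair q a b c)
include h

theorem line_injective (i : ℤ) (l j : ZMod 3) :
    Function.Injective fun s => elt a b c i s (j + l * s) := fun _ _ hs => (h.elt_inj hs).1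

theorem plane_injective (i : ℤ) :
    Function.Injective fun r : ZMod 3 × ZMod 3 => elt a b c i r.1 r.2 := fun _ _ hr =>
  Prod.ext (h.elt_inj hr).1 ((h.elt_inj hr).2.2 rfl)

theorem vert_injective : Function.Injective fun t => elt a b c 0 0 t := fun _ _ hr =>
  (h.elt_inj hr).2.2 rfl

theorem mem_plane {i : ℤ} {x : G} : x ∈ plane a b c i ↔ h.level x = i := by
  constructor
  · rintro ⟨r, rfl⟩
    exact h.level_elt _ _ _
  · intro hx
    obtain ⟨s, t, rfl⟩ := h.exists_elt_of_level hx
    exact ⟨(s, t), rfl⟩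

theorem plane_congr {i i' : ℤ} (hi : (i : ZMod (3 * q)) = i') :
    plane a b c i = plane a b c i' := by
  ext x
  rw [h.mem_plane, h.mem_plane, hi]

theorem setSum_line (i : ℤ) (l j : ZMod 3) : setSum (line a b c i l j) =
    ∑ s, MonoidAlgebra.of ℤ G (elt a b c i s (j + l * s)) :=
  setSum_range (h.line_injective i l j)

theorem setSum_plane (i : ℤ) : setSum (plane a b c i) =
    ∑ s, ∑ t, MonoidAlgebra.of ℤ G (elt a b c i s t) := by
  rw [plane, setSum_range (h.plane_injective i), Fintype.sum_prod_type]

theorem setSum_vert : setSum (vert a b c) = ∑ t, MonoidAlgebra.of ℤ G (elt a b c 0 0 t) :=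
  setSum_range h.vert_injective

theorem ncard_line (i : ℤ) (l j : ZMod 3) : (line a b c i l j).ncard = 3 := by
  rw [line, ← Set.image_univ, Set.ncard_image_of_injective _ (h.line_injective i l j),
    Set.ncard_univ, Nat.card_zmod]

theorem line_add_three (i : ℤ) (l j : ZMod 3) (m : ℤ) :
    line a b c (i + 3 * q * m) l j = line a b c i l (j + m) := by
  unfold line
  congr 1
  ext s
  rw [h.elt_add, add_right_comm]

/-- A line of slope l at level i is a right coset of the order-3 subgroup of slope l and a left
coset of the one of slope l − i. In a product the two inner subgroups either agree, giving three
times a line, or generate the whole group of order 9, giving a plane. -/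
theorem line_mul_line (i i' : ℤ) (l l' j j' : ZMod 3) :
    setSum (line a b c i l j) * setSum (line a b c i' l' j') =
      if l' + i = l then (3 : ℤ) • setSum (line a b c (i + i') l (j + j'))
      else setSum (plane a b c (i + i')) := by
  have h1 : setSum (line a b c i l j) * setSum (line a b c i' l' j') =
      ∑ s, ∑ s', MonoidAlgebra.of ℤ G
        (elt a b c (i + i') s (j + j' + l * s + (l' + i - l) * s')) := by
    rw [h.setSum_line, h.setSum_line, Finset.sum_mul_sum, Finset.sum_comm]
    conv_rhs => rw [Finset.sum_comm]
    refine Finset.sum_congr rfl fun s' _ => ?_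
    -- Summing over the total second coordinate isolates the coefficient l' + i − l of `s'`, which
    -- decides between line and plane.
    rw [← Equiv.sum_comp (Equiv.addRight s')
      fun s => MonoidAlgebra.of ℤ G (elt a b c (i + i') s (j + j' + l * s + (l' + i - l) * s'))]
    refine Finset.sum_congr rfl fun s _ => ?_
    rw [← map_mul, h.elt_mul, Equiv.coe_addRight]
    congr 2
    ring
  rw [h1]
  split_ifs with hl
  · rw [h.setSum_line, Finset.smul_sum]
    refine Finset.sum_congr rfl fun s _ => ?_
    have : l' + i - l = 0 := sub_eq_zero.2 hl
    simp [this]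
  · rw [h.setSum_plane]
    refine Finset.sum_congr rfl fun s _ => ?_
    exact Equiv.sum_comp ((Equiv.mulLeft₀ _ (sub_ne_zero.2 hl)).trans
      (Equiv.addLeft (j + j' + l * s))) fun t => MonoidAlgebra.of ℤ G (elt a b c (i + i') s t)

theorem vert_mul_line (i : ℤ) (l j : ZMod 3) :
    setSum (vert a b c) * setSum (line a b c i l j) = setSum (plane a b c i) := by
  rw [h.setSum_vert, h.setSum_line, h.setSum_plane, Finset.sum_mul_sum, Finset.sum_comm]
  refine Finset.sum_congr rfl fun s _ => ?_
  rw [← Equiv.sum_comp (Equiv.addRight (j + l * s))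
    fun t => MonoidAlgebra.of ℤ G (elt a b c i s t)]
  refine Finset.sum_congr rfl fun t _ => ?_
  rw [← map_mul, h.elt_mul]
  simp [add_assoc]

theorem line_mul_vert (i : ℤ) (l j : ZMod 3) :
    setSum (line a b c i l j) * setSum (vert a b c) = setSum (plane a b c i) := by
  rw [h.setSum_vert, h.setSum_line, h.setSum_plane, Finset.sum_mul_sum]
  refine Finset.sum_congr rfl fun s _ => ?_
  rw [← Equiv.sum_comp (Equiv.addLeft (j + l * s))
    fun t => MonoidAlgebra.of ℤ G (elt a b c i s t)]
  refine Finset.sum_congr rfl fun t _ => ?_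
  rw [← map_mul, h.elt_mul]
  simp [add_assoc]

theorem vert_mul_vert :
    setSum (vert a b c) * setSum (vert a b c) = (3 : ℤ) • setSum (vert a b c) := by
  have : ∀ s : ZMod 3, ∑ t, MonoidAlgebra.of ℤ G (elt a b c 0 0 s) *
      MonoidAlgebra.of ℤ G (elt a b c 0 0 t) = setSum (vert a b c) := by
    intro s
    rw [h.setSum_vert, ← Equiv.sum_comp (Equiv.addLeft s)
      fun t => MonoidAlgebra.of ℤ G (elt a b c 0 0 t)]
    refine Finset.sum_congr rfl fun t _ => ?_
    rw [← map_mul, h.elt_mul]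
    simp
  nth_rewrite 1 [h.setSum_vert]
  nth_rewrite 1 [h.setSum_vert]
  rw [Finset.sum_mul_sum, Finset.sum_congr rfl fun s _ => this s]
  simp

theorem sum_lines (i : ℤ) (l : ZMod 3) :
    ∑ j, setSum (line a b c i l j) = setSum (plane a b c i) := by
  simp_rw [h.setSum_line]
  rw [h.setSum_plane, Finset.sum_comm]
  refine Finset.sum_congr rfl fun s _ => ?_
  exact Equiv.sum_comp (Equiv.addRight (l * s))
    fun t => MonoidAlgebra.of ℤ G (elt a b c i s t)

/-- The plane at level 0 is elementary abelian of order 9. Its four subgroups of order 3 cover it,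
with the identity counted four times. -/
theorem line_add_line : setSum (line a b c 0 1 0) + setSum (line a b c 0 0 0) =
    setSum (plane a b c 0) + (3 : ℤ) • 1 - setSum (vert a b c) - setSum (line a b c 0 (-1) 0) := by
  have hsum : ∀ f : ZMod 3 → MonoidAlgebra ℤ G, ∑ s, f s = f 0 + f 1 + f 2 := Fin.sum_univ_three
  have e1 : (-1 : ZMod 3) = 2 := rfl
  have e2 : (2 : ZMod 3) * 2 = 1 := rfl
  have e3 : (1 : MonoidAlgebra ℤ G) = MonoidAlgebra.of ℤ G (elt a b c 0 0 0) := by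
    rw [elt_zero, map_one]
  rw [h.setSum_line, h.setSum_line, h.setSum_line, h.setSum_plane, h.setSum_vert, e3]
  simp only [hsum, e1, e2, mul_zero, add_zero, zero_mul, mul_one, one_mul, zero_add]
  abel

variable [Finite G]

theorem plane_mul_setSum (i : ℤ) {i' : ℤ} {N : Set G} (hN : N ⊆ plane a b c i') :
    setSum (plane a b c i) * setSum N = (N.ncard : ℤ) • setSum (plane a b c (i + i')) := by
  refine mul_setSum_eq fun g hg => ?_
  rw [setSum_mul_of]
  congr 1
  ext x
  have := h.mem_plane.1 (hN hg)
  rw [Set.mem_ofPred_eq, h.mem_plane, h.mem_plane, h.level_mul_inv, this, sub_eq_iff_eq_add]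
  push_cast
  rfl

theorem setSum_mul_plane {i i' : ℤ} {N : Set G} (hN : N ⊆ plane a b c i) :
    setSum N * setSum (plane a b c i') = (N.ncard : ℤ) • setSum (plane a b c (i' + i)) := by
  refine setSum_mul_eq fun g hg => ?_
  rw [of_mul_setSum]
  congr 1
  ext x
  have := h.mem_plane.1 (hN hg)
  have h2 := h.level_mul_inv g⁻¹ x⁻¹
  rw [inv_inv, h.level_inv, h.level_inv, this] at h2
  rw [Set.mem_ofPred_eq, h.mem_plane, h.mem_plane, h2]
  push_cast
  constructor <;> intro h3 <;> linear_combination h3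

end Sums

end IsModularPair

end SchurRing

/-! ### The S-family over a modular 3-group. -/

namespace SchurRing

variable {G : Type*} [Group G]

namespace IsModularPair

variable {q : ℕ} {a b c : G}

section Family

variable (h : IsModularPair q a b c)

theorem singleton_mem_family : {1} ∈ family a b c q := by simp [family]

theorem vert_mem_family : vert a b c ∈ family a b c q := by simp [family]

theorem line_mem_family : line a b c 0 (-1) 0 ∈ family a b c q := by simp [family]

theorem cross_mem_family : cross a b c ∈ family a b c q := by simp [family]

theorem skewPair_mem_family (j : ZMod 3) : skewPair a b c q j ∈ family a b c q :=
  Or.inl (Or.inr ⟨j, rfl⟩)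

theorem planePair_mem_family (k : ℤ) : planePair a b c k ∈ family a b c q := Or.inr ⟨k, rfl⟩

/-- Case distinction on the members of `family`. -/
theorem family_cases {P : Set G → Prop} (h1 : P {1}) (hv : P (vert a b c))
    (hl : P (line a b c 0 (-1) 0)) (hx : P (cross a b c)) (hT : ∀ j, P (skewPair a b c q j))
    (hp : ∀ k, P (planePair a b c k)) {M : Set G} (hM : M ∈ family a b c q) : P M := by
  rcases hM with ((rfl | rfl | rfl | rfl) | ⟨j, rfl⟩) | ⟨k, rfl⟩
  exacts [h1, hv, hl, hx, hT j, hp k]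

theorem plane_zero_mem :
    setSum (plane a b c 0) ∈ spanOf (family a b c q) := by
  have := setSum_mem_spanOf (planePair_mem_family (a := a) (b := b) (c := c) (q := q) 0)
  rwa [planePair, neg_zero, Set.union_self] at this

include h

theorem mem_planePair {k : ℤ} {x : G} :
    x ∈ planePair a b c k ↔ h.level x = k ∨ h.level x = -k := by
  rw [planePair, Set.mem_union, h.mem_plane, h.mem_plane]
  push_cast
  rfl

theorem level_line {i : ℤ} {l j : ZMod 3} {x : G} (hx : x ∈ line a b c i l j) :
    h.level x = i := h.mem_plane.1 (line_subset_plane i l j hx)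

theorem elt_mem_line {i : ℤ} {s t l j : ZMod 3} :
    elt a b c i s t ∈ line a b c i l j ↔ t = j + l * s := by
  constructor
  · rintro ⟨r, hr⟩
    obtain ⟨rfl, -, hs⟩ := h.elt_inj hr
    exact (hs rfl).symm
  · rintro rfl
    exact ⟨s, rfl⟩

theorem level_vert {x : G} (hx : x ∈ vert a b c) : h.level x = 0 := by
  obtain ⟨t, rfl⟩ := hx
  rw [h.level_elt, Int.cast_zero]

theorem level_cross {x : G} (hx : x ∈ cross a b c) : h.level x = 1 ∨ h.level x = -1 := by
  rcases hx with hx | hx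
  · left
    simpa using h.level_line hx
  · right
    simpa using h.level_line hx

theorem level_skewPair {x : G} {j : ZMod 3} (hx : x ∈ skewPair a b c q j) :
    h.level x = q ∨ h.level x = -q := by
  rcases hx with hx | hx
  · left
    simpa using h.level_line hx
  · right
    simpa using h.level_line hx

/-- Each member of the family lies in a pair of opposite planes. -/
theorem exists_subset_planePair {M : Set G} (hM : M ∈ family a b c q) :
    ∃ k, M ⊆ planePair a b c k := by
  refine family_cases (P := fun M => ∃ k, M ⊆ planePair a b c k) ?_ ?_ ?_ ?_ (fun j => ?_)
    (fun k => ⟨k, subset_rfl⟩) hM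
  · refine ⟨0, fun x hx => h.mem_planePair.2 (Or.inl ?_)⟩
    rw [Set.mem_singleton_iff.1 hx, h.level_one, Int.cast_zero]
  · exact ⟨0, fun x hx => h.mem_planePair.2 (Or.inl (by rw [h.level_vert hx, Int.cast_zero]))⟩
  · exact ⟨0, fun x hx => h.mem_planePair.2 (Or.inl (h.level_line hx))⟩
  · exact ⟨1, fun x hx => h.mem_planePair.2 (by simpa using h.level_cross hx)⟩
  · exact ⟨q, fun x hx => h.mem_planePair.2 (by simpa using h.level_skewPair hx)⟩

theorem subset_planePair_of_mem {M : Set G} (hM : M ∈ family a b c q) {k : ℤ} {x : G}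
    (hx : x ∈ M) (hxk : x ∈ planePair a b c k) : M ⊆ planePair a b c k := by
  obtain ⟨l, hl⟩ := h.exists_subset_planePair hM
  have h1 := h.mem_planePair.1 (hl hx)
  have h2 := h.mem_planePair.1 hxk
  have h3 : (l : ZMod (3 * q)) = k ∨ (l : ZMod (3 * q)) = -k := by
    rcases h1 with h1 | h1 <;> rcases h2 with h2 | h2 <;> rw [h2] at h1
    · exact Or.inl h1.symm
    · exact Or.inr h1.symm
    · exact Or.inr (by rw [h1, neg_neg])
    · exact Or.inl (neg_injective h1.symm)
  intro y hy
  have h4 := h.mem_planePair.1 (hl hy)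
  rw [h.mem_planePair]
  rcases h3 with h3 | h3 <;> rw [h3] at h4
  · exact h4
  · rw [neg_neg] at h4
    exact h4.symm

theorem skewPair_inj {x : G} {i j : ZMod 3} (hi : x ∈ skewPair a b c q i)
    (hj : x ∈ skewPair a b c q j) : i = j := by
  have hq := h.ne_neg_self_level h.q_ne_zero_level
  rcases hi with hi | hi <;> rcases hj with hj | hj
  · obtain ⟨s, rfl⟩ := hi
    have := h.elt_mem_line.1 hj
    simpa using this
  · have h1 := h.level_line hi
    rw [h.level_line hj] at h1
    exact absurd (by simpa using h1.symm) hq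
  · have h1 := h.level_line hi
    rw [h.level_line hj] at h1
    exact absurd (by simpa using h1) hq
  · obtain ⟨s, rfl⟩ := hi
    have := h.elt_mem_line.1 hj
    simpa using this

/-- Level separates members: 0, ±1 and ±q are pairwise distinct modulo 3q because 3 divides q.
Within a level, skew pairs are disjoint, and the only incomparable members are two subgroups of
order 3, which meet trivially. -/
theorem inter_family {M N : Set G} (hM : M ∈ family a b c q) (hN : N ∈ family a b c q) {x : G}
    (hxM : x ∈ M) (hxN : x ∈ N) : M ⊆ N ∨ N ⊆ M ∨ M ∩ N = {1} := by
  have hone : ∀ {N : Set G} {x : G}, x ∈ ({1} : Set G) → x ∈ N → ({1} : Set G) ⊆ N := by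
    rintro N x rfl hx
    exact Set.singleton_subset_iff.2 hx
  have hvl : vert a b c ∩ line a b c 0 (-1) 0 = {1} := by
    ext y
    rw [Set.mem_inter_iff, Set.mem_singleton_iff]
    constructor
    · rintro ⟨⟨t, rfl⟩, hy⟩
      have := h.elt_mem_line.1 hy
      rw [mul_zero, add_zero] at this
      simp only [this, elt_zero]
    · rintro rfl
      rw [← elt_zero (a := a) (b := b) (c := c), h.elt_mem_line]
      exact ⟨⟨0, rfl⟩, by simp⟩
  have hq := h.q_ne_zero_level
  have h10 := h.one_ne_zero_level
  have hq1 := h.q_ne_one_level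
  have hq1' := h.q_ne_neg_one_level
  have hlev0 : h.level x = 0 → h.level x = q ∨ h.level x = -q → False := by
    rintro h0 (h1 | h1) <;> rw [h0] at h1
    · exact hq h1.symm
    · exact hq (neg_eq_zero.1 h1.symm)
  have hlev1 : h.level x = 0 → h.level x = 1 ∨ h.level x = -1 → False := by
    rintro h0 (h1 | h1) <;> rw [h0] at h1
    · exact h10 h1.symm
    · exact h10 (neg_eq_zero.1 h1.symm)
  have hlevq : h.level x = 1 ∨ h.level x = -1 → h.level x = q ∨ h.level x = -q → False := by
    rintro (h0 | h0) (h1 | h1) <;> rw [h0] at h1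
    · exact hq1 h1.symm
    · exact hq1' (by rw [h1, neg_neg])
    · exact hq1' h1.symm
    · exact hq1 (neg_injective h1.symm)
  have hl0 : x ∈ line a b c 0 (-1) 0 → h.level x = 0 := fun hx => by
    simpa using h.level_line hx
  rcases hM with ((rfl | rfl | rfl | rfl) | ⟨i, rfl⟩) | ⟨k, rfl⟩
  · exact Or.inl (hone hxM hxN)
  · rcases hN with ((rfl | rfl | rfl | rfl) | ⟨j, rfl⟩) | ⟨l, rfl⟩
    · exact Or.inr (Or.inl (hone hxN hxM))
    · exact Or.inl subset_rfl
    · exact Or.inr (Or.inr hvl)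
    · exact (hlev1 (h.level_vert hxM) (h.level_cross hxN)).elim
    · exact (hlev0 (h.level_vert hxM) (h.level_skewPair hxN)).elim
    · exact Or.inl (h.subset_planePair_of_mem vert_mem_family hxM hxN)
  · rcases hN with ((rfl | rfl | rfl | rfl) | ⟨j, rfl⟩) | ⟨l, rfl⟩
    · exact Or.inr (Or.inl (hone hxN hxM))
    · exact Or.inr (Or.inr (Set.inter_comm _ _ ▸ hvl))
    · exact Or.inl subset_rfl
    · exact (hlev1 (hl0 hxM) (h.level_cross hxN)).elim
    · exact (hlev0 (hl0 hxM) (h.level_skewPair hxN)).elim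
    · exact Or.inl (h.subset_planePair_of_mem line_mem_family hxM hxN)
  · rcases hN with ((rfl | rfl | rfl | rfl) | ⟨j, rfl⟩) | ⟨l, rfl⟩
    · exact Or.inr (Or.inl (hone hxN hxM))
    · exact (hlev1 (h.level_vert hxN) (h.level_cross hxM)).elim
    · exact (hlev1 (hl0 hxN) (h.level_cross hxM)).elim
    · exact Or.inl subset_rfl
    · exact (hlevq (h.level_cross hxM) (h.level_skewPair hxN)).elim
    · exact Or.inl (h.subset_planePair_of_mem cross_mem_family hxM hxN)
  · rcases hN with ((rfl | rfl | rfl | rfl) | ⟨j, rfl⟩) | ⟨l, rfl⟩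
    · exact Or.inr (Or.inl (hone hxN hxM))
    · exact (hlev0 (h.level_vert hxN) (h.level_skewPair hxM)).elim
    · exact (hlev0 (hl0 hxN) (h.level_skewPair hxM)).elim
    · exact (hlevq (h.level_cross hxN) (h.level_skewPair hxM)).elim
    · rw [h.skewPair_inj hxM hxN]
      exact Or.inl subset_rfl
    · exact Or.inl (h.subset_planePair_of_mem (skewPair_mem_family i) hxM hxN)
  · exact Or.inr (Or.inl (h.subset_planePair_of_mem hN hxN hxM))

theorem inter_mem_family {M N : Set G} (hM : M ∈ family a b c q) (hN : N ∈ family a b c q)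
    (hMN : (M ∩ N).Nonempty) : M ∩ N ∈ family a b c q := by
  obtain ⟨x, hxM, hxN⟩ := hMN
  rcases h.inter_family hM hN hxM hxN with h1 | h1 | h1
  · rwa [Set.inter_eq_left.2 h1]
  · rwa [Set.inter_eq_right.2 h1]
  · rw [h1]
    exact singleton_mem_family

theorem inv_mem_line {i : ℤ} {l j : ZMod 3} {x : G} :
    x⁻¹ ∈ line a b c i l j ↔ x ∈ line a b c (-i) (l - i) (-j) := by
  have key : ∀ (i : ℤ) (l j : ZMod 3) (x : G), x ∈ line a b c i l j →
      x⁻¹ ∈ line a b c (-i) (l - i) (-j) := by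
    rintro i l j _ ⟨s, rfl⟩
    change (elt a b c i s (j + l * s))⁻¹ ∈ _
    rw [h.elt_inv, h.elt_mem_line]
    ring
  refine ⟨fun hx => by simpa using key _ _ _ _ hx, fun hx => ?_⟩
  have := key _ _ _ _ hx
  simpa using this

theorem inv_mem_family {M : Set G} (hM : M ∈ family a b c q) :
    {x : G | x⁻¹ ∈ M} ∈ family a b c q := by
  suffices hs : ∀ x ∈ M, x⁻¹ ∈ M by
    have : {x : G | x⁻¹ ∈ M} = M := by
      ext x
      exact ⟨fun hx => by simpa using hs _ hx, hs x⟩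
    rwa [this]
  refine family_cases (P := fun M => ∀ x ∈ M, x⁻¹ ∈ M) ?_ ?_ ?_ ?_ (fun j => ?_) (fun k => ?_) hM
  · rintro x rfl
    simp
  · rintro _ ⟨t, rfl⟩
    refine ⟨-t, ?_⟩
    simp [h.elt_inv]
  · intro x hx
    rw [h.inv_mem_line]
    simpa using hx
  · rintro x (hx | hx)
    · right
      rw [h.inv_mem_line]
      simpa using hx
    · left
      rw [h.inv_mem_line]
      simpa using hx
  · rintro x (hx | hx)
    · right
      rw [h.inv_mem_line]
      simpa [h.cast_q] using hx
    · left
      rw [h.inv_mem_line]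
      simpa [h.cast_q] using hx
  · intro x hx
    rw [h.mem_planePair] at hx ⊢
    rw [h.level_inv]
    rcases hx with hx | hx
    · right
      rw [hx]
    · left
      rw [hx, neg_neg]

theorem vert_mul_mem : setSum (vert a b c) * setSum (line a b c 0 (-1) 0) ∈
    spanOf (family a b c q) ∧ setSum (line a b c 0 (-1) 0) * setSum (vert a b c) ∈
    spanOf (family a b c q) := by
  rw [h.vert_mul_line, h.line_mul_vert]
  exact ⟨plane_zero_mem, plane_zero_mem⟩

theorem line_mul_self_mem : setSum (line a b c 0 (-1) 0) * setSum (line a b c 0 (-1) 0) ∈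
    spanOf (family a b c q) := by
  rw [h.line_mul_line, if_pos (by simp), add_zero, add_zero]
  exact Submodule.smul_mem _ _ (setSum_mem_spanOf line_mem_family)

/-- The lines of slope −1 at offsets 1 and 2 are separately outside the family, but their sum is the
plane minus the subgroup line. -/
theorem line_add_line_neg_mem (d : ZMod 3) :
    setSum (line a b c 0 (-1) d) + setSum (line a b c 0 (-1) (-d)) ∈ spanOf (family a b c q) := by
  have hl := setSum_mem_spanOf (line_mem_family (a := a) (b := b) (c := c) (q := q))
  have hs : setSum (line a b c 0 (-1) 1) + setSum (line a b c 0 (-1) 2) ∈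
      spanOf (family a b c q) := by
    have h1 := h.sum_lines 0 (-1)
    rw [show ∑ j, setSum (line a b c 0 (-1) j) = setSum (line a b c 0 (-1) 0) +
      setSum (line a b c 0 (-1) 1) + setSum (line a b c 0 (-1) 2) from Fin.sum_univ_three _,
      add_assoc] at h1
    rw [← eq_sub_iff_add_eq'] at h1
    rw [h1]
    exact Submodule.sub_mem _ plane_zero_mem hl
  rcases d.three_cases with rfl | rfl | rfl
  · rw [neg_zero]
    exact Submodule.add_mem _ hl hl
  · exact hs
  · rw [add_comm]
    exact hs

end Family

section Products

variable [Finite G] (h : IsModularPair q a b c)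
include h

theorem setSum_skewPair (j : ZMod 3) : setSum (skewPair a b c q j) =
    setSum (line a b c q (-1) j) + setSum (line a b c (-q) (-1) (-j)) := by
  refine setSum_union (Set.disjoint_left.2 fun x hx hx' => ?_)
  have h1 := h.level_line hx
  rw [h.level_line hx'] at h1
  exact h.ne_neg_self_level h.q_ne_zero_level (by simpa using h1.symm)

theorem setSum_cross : setSum (cross a b c) =
    setSum (line a b c 1 1 0) + setSum (line a b c (-1) 0 0) := by
  refine setSum_union (Set.disjoint_left.2 fun x hx hx' => ?_)
  have h1 := h.level_line hx
  rw [h.level_line hx'] at h1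
  exact h.ne_neg_self_level h.one_ne_zero_level (by simpa using h1.symm)

/-- At level 0 the two opposite planes coincide, so their union must not be counted twice. -/
theorem setSum_planePair (k : ℤ) :
    ((k : ZMod (3 * q)) = 0 ∧ setSum (planePair a b c k) = setSum (plane a b c 0)) ∨
      setSum (planePair a b c k) = setSum (plane a b c k) + setSum (plane a b c (-k)) := by
  by_cases hk : (k : ZMod (3 * q)) = 0
  · refine Or.inl ⟨hk, ?_⟩
    rw [planePair, h.plane_congr (i := k) (i' := 0) (by simpa using hk),
      h.plane_congr (i := -k) (i' := 0) (by simpa using hk), Set.union_self]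
  · refine Or.inr (setSum_union (Set.disjoint_left.2 fun x hx hx' => ?_))
    have h1 := h.mem_plane.1 hx
    rw [h.mem_plane.1 hx'] at h1
    exact h.ne_neg_self_level hk (by simpa using h1.symm)

theorem plane_add_mem (k : ℤ) :
    setSum (plane a b c k) + setSum (plane a b c (-k)) ∈ spanOf (family a b c q) := by
  have h0 : setSum (plane a b c 0) ∈ spanOf (family a b c q) := plane_zero_mem
  rcases h.setSum_planePair k with ⟨hk, -⟩ | hk
  · rw [h.plane_congr (i := k) (i' := 0) (by simpa using hk),
      h.plane_congr (i := -k) (i' := 0) (by simpa using hk)]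
    exact Submodule.add_mem _ h0 h0
  · rw [← hk]
    exact setSum_mem_spanOf (planePair_mem_family k)

/-- Multiplication by each member of the family maps sums of planes to sums of planes. -/
theorem exists_mul_plane {M : Set G} (hM : M ∈ family a b c q) : ∃ n l : ℤ,
    (∀ k, setSum M * setSum (plane a b c k) = n • setSum (plane a b c k) ∧
      setSum (plane a b c k) * setSum M = n • setSum (plane a b c k)) ∨
    (∀ k, setSum M * setSum (plane a b c k) =
        n • (setSum (plane a b c (k + l)) + setSum (plane a b c (k - l))) ∧
      setSum (plane a b c k) * setSum M =
        n • (setSum (plane a b c (k + l)) + setSum (plane a b c (k - l)))) := by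
  have h0 : ∀ {M : Set G}, M ⊆ plane a b c 0 → ∀ k,
      setSum M * setSum (plane a b c k) = (M.ncard : ℤ) • setSum (plane a b c k) ∧
        setSum (plane a b c k) * setSum M = (M.ncard : ℤ) • setSum (plane a b c k) := by
    intro M hM k
    have h1 := h.plane_mul_setSum k hM
    have h2 := h.setSum_mul_plane (i' := k) hM
    rw [add_zero] at h1 h2
    exact ⟨h2, h1⟩
  have hadd : ∀ {M N : Set G} {l : ℤ} {n : ℕ}, M ⊆ plane a b c l → N ⊆ plane a b c (-l) →
      M.ncard = n → N.ncard = n → ∀ k, (setSum M + setSum N) * setSum (plane a b c k) =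
        (n : ℤ) • (setSum (plane a b c (k + l)) + setSum (plane a b c (k - l))) ∧
      setSum (plane a b c k) * (setSum M + setSum N) =
        (n : ℤ) • (setSum (plane a b c (k + l)) + setSum (plane a b c (k - l))) := by
    intro M N l n hM hN hMn hNn k
    rw [add_mul, mul_add, h.setSum_mul_plane hM, h.setSum_mul_plane hN, h.plane_mul_setSum k hM,
      h.plane_mul_setSum k hN, hMn, hNn, ← smul_add, sub_eq_add_neg]
    exact ⟨rfl, rfl⟩
  have hcard : ∀ k, (plane a b c k).ncard = 9 := fun k => by
    rw [plane, ← Set.image_univ, Set.ncard_image_of_injective _ (h.plane_injective k),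
      Set.ncard_univ, Nat.card_prod, Nat.card_zmod]
  refine family_cases (P := fun M => ∃ n l : ℤ,
    (∀ k, setSum M * setSum (plane a b c k) = n • setSum (plane a b c k) ∧
      setSum (plane a b c k) * setSum M = n • setSum (plane a b c k)) ∨
    (∀ k, setSum M * setSum (plane a b c k) =
        n • (setSum (plane a b c (k + l)) + setSum (plane a b c (k - l))) ∧
      setSum (plane a b c k) * setSum M =
        n • (setSum (plane a b c (k + l)) + setSum (plane a b c (k - l)))))
    ⟨_, 0, Or.inl (h0 ?_)⟩ ⟨_, 0, Or.inl (h0 ?_)⟩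
    ⟨_, 0, Or.inl (h0 (line_subset_plane _ _ _))⟩ ⟨3, 1, Or.inr ?_⟩
    (fun j => ⟨3, q, Or.inr ?_⟩) (fun m => ?_) hM
  · rintro x rfl
    rw [h.mem_plane, h.level_one, Int.cast_zero]
  · intro x hx
    rw [h.mem_plane, h.level_vert hx, Int.cast_zero]
  · rw [h.setSum_cross]
    exact hadd (line_subset_plane _ _ _) (line_subset_plane _ _ _) (h.ncard_line _ _ _)
      (h.ncard_line _ _ _)
  · rw [h.setSum_skewPair]
    exact hadd (line_subset_plane _ _ _) (line_subset_plane _ _ _) (h.ncard_line _ _ _)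
      (h.ncard_line _ _ _)
  · rcases h.setSum_planePair m with ⟨-, hm⟩ | hm
    · exact ⟨_, 0, Or.inl (by rw [hm]; exact h0 subset_rfl)⟩
    · refine ⟨9, m, Or.inr ?_⟩
      rw [hm]
      exact hadd subset_rfl subset_rfl (hcard _) (hcard _)

theorem mul_planePair_mem {M : Set G} (hM : M ∈ family a b c q) (k : ℤ) :
    setSum M * setSum (planePair a b c k) ∈ spanOf (family a b c q) ∧
      setSum (planePair a b c k) * setSum M ∈ spanOf (family a b c q) := by
  obtain ⟨n, l, hn⟩ := h.exists_mul_plane hM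
  rcases h.setSum_planePair k with ⟨-, hk⟩ | hk
  · rw [hk]
    rcases hn with hn | hn <;> rw [(hn 0).1, (hn 0).2]
    · exact ⟨Submodule.smul_mem _ _ plane_zero_mem, Submodule.smul_mem _ _ plane_zero_mem⟩
    · rw [zero_add, zero_sub]
      exact ⟨Submodule.smul_mem _ _ (h.plane_add_mem l),
        Submodule.smul_mem _ _ (h.plane_add_mem l)⟩
  · rw [hk, mul_add, add_mul]
    rcases hn with hn | hn <;> rw [(hn k).1, (hn k).2, (hn (-k)).1, (hn (-k)).2, ← smul_add]
    · exact ⟨Submodule.smul_mem _ _ (h.plane_add_mem k),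
        Submodule.smul_mem _ _ (h.plane_add_mem k)⟩
    · have h1 := h.plane_add_mem (k + l)
      have h2 := h.plane_add_mem (k - l)
      rw [neg_add', neg_sub'] at *
      have h3 : setSum (plane a b c (k + l)) + setSum (plane a b c (k - l)) +
          (setSum (plane a b c (-k + l)) + setSum (plane a b c (-k - l))) ∈
            spanOf (family a b c q) := by
        have := Submodule.add_mem _ h1 h2
        rw [sub_neg_eq_add] at this
        convert this using 1
        abel
      exact ⟨Submodule.smul_mem _ _ h3, Submodule.smul_mem _ _ h3⟩

theorem vert_mul_cross_mem : setSum (vert a b c) * setSum (cross a b c) ∈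
    spanOf (family a b c q) ∧ setSum (cross a b c) * setSum (vert a b c) ∈
    spanOf (family a b c q) := by
  rw [h.setSum_cross, mul_add, add_mul, h.vert_mul_line, h.line_mul_vert, h.vert_mul_line,
    h.line_mul_vert]
  exact ⟨h.plane_add_mem 1, h.plane_add_mem 1⟩

theorem vert_mul_skewPair_mem (j : ZMod 3) : setSum (vert a b c) * setSum (skewPair a b c q j) ∈
    spanOf (family a b c q) ∧ setSum (skewPair a b c q j) * setSum (vert a b c) ∈
    spanOf (family a b c q) := by
  rw [h.setSum_skewPair, mul_add, add_mul, h.vert_mul_line, h.line_mul_vert, h.vert_mul_line,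
    h.line_mul_vert]
  exact ⟨h.plane_add_mem q, h.plane_add_mem q⟩

theorem line_mul_cross_mem : setSum (line a b c 0 (-1) 0) * setSum (cross a b c) ∈
    spanOf (family a b c q) ∧ setSum (cross a b c) * setSum (line a b c 0 (-1) 0) ∈
    spanOf (family a b c q) := by
  rw [h.setSum_cross, mul_add, add_mul, h.line_mul_line, h.line_mul_line, h.line_mul_line,
    h.line_mul_line, if_neg (by decide), if_neg (by decide), if_neg (by decide),
    if_neg (by decide)]
  simp only [zero_add, add_zero]
  exact ⟨h.plane_add_mem 1, h.plane_add_mem 1⟩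

theorem line_mul_skewPair_mem (j : ZMod 3) :
    setSum (line a b c 0 (-1) 0) * setSum (skewPair a b c q j) ∈ spanOf (family a b c q) ∧
    setSum (skewPair a b c q j) * setSum (line a b c 0 (-1) 0) ∈ spanOf (family a b c q) := by
  rw [h.setSum_skewPair, mul_add, add_mul, h.line_mul_line, h.line_mul_line, h.line_mul_line,
    h.line_mul_line, if_pos (by simp), if_pos (by simp), if_pos (by simp [h.cast_q]),
    if_pos (by simp [h.cast_q])]
  simp only [zero_add, add_zero, ← smul_add]
  rw [← h.setSum_skewPair]
  have := Submodule.smul_mem (spanOf (family a b c q)) (3 : ℤ)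
    (setSum_mem_spanOf (skewPair_mem_family (a := a) (b := b) (c := c) (q := q) j))
  exact ⟨this, this⟩

theorem cross_mul_skewPair_mem (j : ZMod 3) :
    setSum (cross a b c) * setSum (skewPair a b c q j) ∈ spanOf (family a b c q) ∧
    setSum (skewPair a b c q j) * setSum (cross a b c) ∈ spanOf (family a b c q) := by
  have h1 := Submodule.add_mem _ (h.plane_add_mem (1 + q)) (h.plane_add_mem (1 - q))
  have h2 : ∀ l : ZMod 3, l ≠ -1 → ¬ (l + ((q : ℤ) : ZMod 3) = -1) := fun l hl => by
    simpa [h.cast_q] using hl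
  have h3 : ∀ l : ZMod 3, l ≠ -1 → ¬ (l + ((-q : ℤ) : ZMod 3) = -1) := fun l hl => by
    simpa [h.cast_q] using hl
  rw [h.setSum_cross, h.setSum_skewPair]
  simp only [add_mul, mul_add, h.line_mul_line]
  rw [if_neg (by decide), if_neg (by decide), if_neg (by decide), if_neg (by decide),
    if_neg (h2 1 (by decide)), if_neg (h3 1 (by decide)), if_neg (h2 0 (by decide)),
    if_neg (h3 0 (by decide))]
  constructor
  · convert h1 using 1
    rw [show -(1 + (q : ℤ)) = -1 + -q by ring, show -(1 - (q : ℤ)) = -1 + q by ring,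
      show 1 - (q : ℤ) = 1 + -q by ring]
    abel
  · convert h1 using 1
    rw [show -(1 + (q : ℤ)) = -q + -1 by ring, show -(1 - (q : ℤ)) = q + -1 by ring,
      show 1 - (q : ℤ) = -q + 1 by ring, add_comm 1 (q : ℤ)]
    abel

/-- The two mixed products give three times the subgroups of slopes 1 and 0. Neither belongs to the
family, but `line_add_line` puts their sum in the span. -/
theorem cross_mul_self_mem :
    setSum (cross a b c) * setSum (cross a b c) ∈ spanOf (family a b c q) := by
  rw [h.setSum_cross]
  simp only [add_mul, mul_add, h.line_mul_line]
  rw [if_neg (by decide), if_pos (by decide), if_pos (by decide), if_neg (by decide)]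
  have h0 := setSum_mem_spanOf (singleton_mem_family (a := a) (b := b) (c := c) (q := q))
  rw [setSum_singleton, map_one] at h0
  have h1 : setSum (line a b c 0 1 0) + setSum (line a b c 0 0 0) ∈ spanOf (family a b c q) := by
    rw [h.line_add_line]
    exact Submodule.sub_mem _ (Submodule.sub_mem _ (Submodule.add_mem _ plane_zero_mem
      (Submodule.smul_mem _ _ h0)) (setSum_mem_spanOf vert_mem_family))
      (setSum_mem_spanOf line_mem_family)
  convert Submodule.add_mem _ (h.plane_add_mem 2) (Submodule.smul_mem _ (3 : ℤ) h1) using 1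
  norm_num
  abel

/-- Levels ±q are 0 modulo 3, so all these lines are two-sided cosets of the slope −1 subgroup.
Modulo it the levels 0, ±q form a cyclic group of order 9, and skew pairs are inverse pairs of its
generators. -/
theorem skewPair_mul_skewPair_mem (i j : ZMod 3) :
    setSum (skewPair a b c q i) * setSum (skewPair a b c q j) ∈ spanOf (family a b c q) := by
  have h1 := setSum_mem_spanOf
    (skewPair_mem_family (a := a) (b := b) (c := c) (q := q) (-(i + j + 1)))
  have h2 := h.line_add_line_neg_mem (i - j)
  rw [h.setSum_skewPair] at h1
  rw [h.setSum_skewPair, h.setSum_skewPair]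
  simp only [add_mul, mul_add, h.line_mul_line]
  rw [if_pos (by simp [h.cast_q]), if_pos (by simp [h.cast_q]), if_pos (by simp [h.cast_q]),
    if_pos (by simp [h.cast_q])]
  -- Level 2q is −q plus a full turn 3q, which contributes the extra 1 in the offset.
  have e1 : line a b c (q + q) (-1) (i + j) = line a b c (-q) (-1) (- -(i + j + 1)) := by
    rw [show (q : ℤ) + q = -q + 3 * q * 1 by ring, h.line_add_three]
    simp
  have e2 : line a b c (-q + -q) (-1) (-i + -j) = line a b c q (-1) (-(i + j + 1)) := by
    rw [show -(q : ℤ) + -q = q + 3 * q * (-1) by ring, h.line_add_three]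
    congr 1
    push_cast
    ring
  rw [e1, e2, show (q : ℤ) + -q = 0 by ring, show -(q : ℤ) + q = 0 by ring,
    show i + -j = i - j by ring, show -i + j = -(i - j) by ring]
  convert Submodule.smul_mem _ (3 : ℤ) (Submodule.add_mem _ h1 h2) using 1
  simp only [smul_add]
  abel

theorem mul_mem_family {M N : Set G} (hM : M ∈ family a b c q) (hN : N ∈ family a b c q) :
    setSum M * setSum N ∈ spanOf (family a b c q) := by
  have hone : setSum ({1} : Set G) = 1 := by rw [setSum_singleton, map_one]
  rcases hN with ((rfl | rfl | rfl | rfl) | ⟨j, rfl⟩) | ⟨l, rfl⟩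
  · rw [hone, mul_one]
    exact setSum_mem_spanOf hM
  · rcases hM with ((rfl | rfl | rfl | rfl) | ⟨i, rfl⟩) | ⟨k, rfl⟩
    · rw [hone, one_mul]
      exact setSum_mem_spanOf vert_mem_family
    · rw [h.vert_mul_vert]
      exact Submodule.smul_mem _ _ (setSum_mem_spanOf vert_mem_family)
    · exact h.vert_mul_mem.2
    · exact h.vert_mul_cross_mem.2
    · exact (h.vert_mul_skewPair_mem i).2
    · exact (h.mul_planePair_mem vert_mem_family k).2
  · rcases hM with ((rfl | rfl | rfl | rfl) | ⟨i, rfl⟩) | ⟨k, rfl⟩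
    · rw [hone, one_mul]
      exact setSum_mem_spanOf line_mem_family
    · exact h.vert_mul_mem.1
    · exact h.line_mul_self_mem
    · exact h.line_mul_cross_mem.2
    · exact (h.line_mul_skewPair_mem i).2
    · exact (h.mul_planePair_mem line_mem_family k).2
  · rcases hM with ((rfl | rfl | rfl | rfl) | ⟨i, rfl⟩) | ⟨k, rfl⟩
    · rw [hone, one_mul]
      exact setSum_mem_spanOf cross_mem_family
    · exact h.vert_mul_cross_mem.1
    · exact h.line_mul_cross_mem.1
    · exact h.cross_mul_self_mem
    · exact (h.cross_mul_skewPair_mem i).2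
    · exact (h.mul_planePair_mem cross_mem_family k).2
  · rcases hM with ((rfl | rfl | rfl | rfl) | ⟨i, rfl⟩) | ⟨k, rfl⟩
    · rw [hone, one_mul]
      exact setSum_mem_spanOf (skewPair_mem_family j)
    · exact (h.vert_mul_skewPair_mem j).1
    · exact (h.line_mul_skewPair_mem j).1
    · exact (h.cross_mul_skewPair_mem j).1
    · exact h.skewPair_mul_skewPair_mem i j
    · exact (h.mul_planePair_mem (skewPair_mem_family j) k).2
  · exact (h.mul_planePair_mem hM l).1

theorem isSFamily_family : IsSFamily (family a b c q) where
  one_mem := singleton_mem_family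
  cover x := by
    obtain ⟨i, s, t, rfl⟩ := h.exists_elt x
    exact ⟨_, planePair_mem_family i, h.mem_planePair.2 (Or.inl (h.level_elt i s t))⟩
  inv_mem _ hM := h.inv_mem_family hM
  inter_mem _ hM _ hN hMN := h.inter_mem_family hM hN hMN
  mul_mem _ hM _ hN := h.mul_mem_family hM hN

end Products

end IsModularPair

end SchurRing

/-! ### No automorphism exchanges the chosen points. -/

namespace SchurRing

variable {G : Type*} [Group G]

/-- A system of functions that would arise from an automorphism of a Cayley scheme over a modular
`3`-group cannot exist. -/
theorem false_of_shift_system {q : ℕ} (hq : Odd q) (φ : ℤ → ZMod 3 → ZMod 3)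
    (h1 : ∀ i x y x' y', x + y = x' + y' →
      φ i x + φ (i - 1) y = φ (i + q) x' + φ (i + q - 1) y')
    (h2 : ∀ i x, φ (i + 3 * q) (x - 1) = φ i x - 1) (h00 : φ 0 0 = 0) (h01 : φ 0 1 = 2) :
    False := by
  -- The arguments (x + 1, y) and (x, y + 1) have the same sum, so increments at adjacent levels
  -- agree for all x and y. Hence every φ i is affine with one common slope, which is 2 by the
  -- values at level 0.
  have hD : ∀ i x y, φ i (x + 1) - φ i x = φ (i - 1) (y + 1) - φ (i - 1) y := by
    intro i x y
    have e1 := h1 i (x + 1) y (x + y + 1) 0 (by ring)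
    have e2 := h1 i x (y + 1) (x + y + 1) 0 (by ring)
    linear_combination e1 - e2
  have hslope : ∀ i x, φ i (x + 1) - φ i x = 2 := by
    have hone : ∀ x, φ 1 (x + 1) - φ 1 x = 2 := by
      intro x
      have := hD 1 x 0
      rw [sub_self, zero_add, h01, h00, sub_zero] at this
      exact this
    intro i
    induction i using Int.induction_on with
    | zero =>
      intro x
      have := hD 1 0 x
      rw [hone, sub_self] at this
      exact this.symm
    | succ n ih =>
      intro x
      have := hD (n + 1) x 0
      rw [add_sub_cancel_right, ih] at this
      exact this
    | pred n ih =>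
      intro x
      rw [← hD _ 0 x, ih]
  have hwrap : ∀ i, φ (i + 3 * q) 0 = φ i 0 + 1 := by
    intro i
    have e1 := h2 i 0
    have e2 := hslope (i + 3 * q) (0 - 1)
    rw [sub_add_cancel] at e2
    linear_combination e1 + e2
  -- The increment of φ(0) over a step of q levels changes sign from one level to the next.
  have hd : ∀ i, φ (i + q) 0 - φ i 0 = -(φ (i - 1 + q) 0 - φ (i - 1) 0) := by
    intro i
    have e1 := h1 i 0 0 0 0 rfl
    rw [show i - 1 + (q : ℤ) = i + q - 1 by ring]
    linear_combination -e1
  have hpow : ∀ (n : ℕ) i, φ (i + n + q) 0 - φ (i + n) 0 = (-1) ^ n * (φ (i + q) 0 - φ i 0) := by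
    intro n
    induction n with
    | zero => simp
    | succ n ih =>
      intro i
      rw [hd, pow_succ, mul_neg_one, neg_mul, ← ih]
      push_cast
      rw [← add_assoc, add_sub_cancel_right]
  -- Three steps of length q make a full turn and total 1. As q is odd, the increments are d, −d, d,
  -- so d = 1 at every level, against the sign change.
  have hdone : ∀ i, φ (i + q) 0 - φ i 0 = 1 := by
    intro i
    have e1 := hpow q i
    have e2 := hpow q (i + q)
    have e3 := hwrap i
    rw [hq.neg_one_pow] at e1 e2
    rw [show i + 3 * (q : ℤ) = i + q + q + q by ring] at e3
    linear_combination e3 - e2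
  have e1 := hd 0
  rw [hdone, hdone] at e1
  exact absurd e1 (by decide)

namespace IsModularPair

variable {q : ℕ} {a b c : G}

theorem elt_mem_cross (h : IsModularPair q a b c) {s t : ZMod 3} :
    elt a b c 1 s t ∈ cross a b c ↔ t = s := by
  constructor
  · rintro (hx | hx)
    · simpa using h.elt_mem_line.1 hx
    · have h1 := h.level_line hx
      rw [h.level_elt] at h1
      exact absurd (by simpa using h1) (h.ne_neg_self_level h.one_ne_zero_level)
  · rintro rfl
    exact Or.inl (h.elt_mem_line.2 (by simp))

theorem elt_mem_skewPair (h : IsModularPair q a b c) {s t : ZMod 3} :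
    elt a b c q s t ∈ skewPair a b c q 0 ↔ t = -s := by
  constructor
  · rintro (hx | hx)
    · simpa using h.elt_mem_line.1 hx
    · have h1 := h.level_line hx
      rw [h.level_elt] at h1
      exact absurd (by simpa using h1) (h.ne_neg_self_level h.q_ne_zero_level)
  · rintro rfl
    exact Or.inl (h.elt_mem_line.2 (by simp))

/-- At level 1 only the cross and plane pairs can occur, and both points lie off the cross. -/
theorem unseparated (h : IsModularPair q a b c) :
    Unseparated (family a b c q) (elt a b c 1 0 1) (elt a b c 1 0 2) := by
  have hlev : ∀ t, h.level (elt a b c 1 0 t) = 1 := fun t => by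
    rw [h.level_elt, Int.cast_one]
  have h10 := h.one_ne_zero_level
  intro M hM
  refine family_cases (P := fun M => elt a b c 1 0 1 ∈ M ↔ elt a b c 1 0 2 ∈ M) (M := M)
    ?_ ?_ ?_ ?_ ?_ ?_ hM
  · refine iff_of_false ?_ ?_ <;> intro hx <;>
    · have := congrArg h.level (Set.mem_singleton_iff.1 hx)
      rw [hlev, h.level_one] at this
      exact h10 this
  · refine iff_of_false ?_ ?_ <;> intro hx <;>
    · have := h.level_vert hx
      rw [hlev] at this
      exact h10 this
  · refine iff_of_false ?_ ?_ <;> intro hx <;>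
    · have := h.level_line hx
      rw [hlev, Int.cast_zero] at this
      exact h10 this
  · rw [h.elt_mem_cross, h.elt_mem_cross]
    decide
  · intro j
    refine iff_of_false ?_ ?_ <;> intro hx <;>
    · have := h.level_skewPair hx
      rw [hlev] at this
      rcases this with h1 | h1
      · exact h.q_ne_one_level h1.symm
      · exact h.q_ne_neg_one_level (by rw [h1, neg_neg])
  · intro k
    rw [h.mem_planePair, h.mem_planePair, hlev, hlev]

theorem not_isSchurFamilyGroup [Finite G] (h : IsModularPair q a b c) :
    ¬ IsSchurFamilyGroup G := by
  intro hG
  obtain ⟨f, hf1, hfx, hf⟩ := hG _ h.isSFamily_family _ _ h.unseparated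
  have hpm : ∀ u v, h.level (f v) - h.level (f u) = h.level v - h.level u ∨
      h.level (f v) - h.level (f u) = -(h.level v - h.level u) := by
    intro u v
    obtain ⟨i, s, t, hist⟩ := h.exists_elt (v * u⁻¹)
    have h1 : h.level v - h.level u = i := by rw [← h.level_mul_inv, hist, h.level_elt]
    have h2 := (hf _ (planePair_mem_family i) u v).1
      (h.mem_planePair.2 (Or.inl (by rw [h.level_mul_inv, h1])))
    rw [h.mem_planePair, h.level_mul_inv] at h2
    rwa [h1]
  -- Plane pairs preserve levels up to sign relative to any base point. Using both 1 and the chosen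
  -- point at level 1, whose levels are kept, excludes the sign change.
  have hlev : ∀ x, h.level (f x) = h.level x := by
    intro x
    have h1 := hpm 1 x
    have h2 := hpm (elt a b c 1 0 1) x
    rw [hf1, h.level_one, sub_zero, sub_zero] at h1
    rw [hfx, h.level_elt, h.level_elt, Int.cast_one] at h2
    rcases h1 with h1 | h1
    · exact h1
    · rcases h2 with h2 | h2
      · exact sub_left_injective h2
      · exact absurd (h.two_ne_zero_level (by linear_combination h1 - h2)) h.one_ne_zero_level
  have hco : ∀ i s t, ∃ s' t', f (elt a b c i s t) = elt a b c i s' t' := fun i s t =>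
    h.exists_elt_of_level (by rw [hlev, h.level_elt])
  choose S T hST using hco
  -- Cross relations between consecutive levels ignore the second coordinate of the lower point;
  -- hence `T` depends only on level and third coordinate, and determines `S`.
  have hcross : ∀ i s t s' t', t' - s' = t →
      T (i + 1) s' t' - S (i + 1) s' t' = T i s t := by
    intro i s t s' t' ht
    have h1 := hf _ cross_mem_family (elt a b c i s t) (elt a b c (i + 1) s' t')
    rw [hST, hST, h.elt_mul_inv, h.elt_mul_inv, add_sub_cancel_left, h.elt_mem_cross,
      h.elt_mem_cross, Int.cast_one, one_mul, one_mul] at h1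
    have h2 := h1.1 (by linear_combination ht)
    linear_combination h2
  have hskew : ∀ i s t s' t', t' + s' = t + s →
      T (i + q) s' t' + S (i + q) s' t' = T i s t + S i s t := by
    intro i s t s' t' ht
    have h1 := hf _ (skewPair_mem_family 0) (elt a b c i s t) (elt a b c (i + q) s' t')
    rw [hST, hST, h.elt_mul_inv, h.elt_mul_inv, add_sub_cancel_left, h.elt_mem_skewPair,
      h.elt_mem_skewPair, Int.cast_natCast, h.cast_q, zero_mul, zero_mul, sub_zero,
      sub_zero] at h1
    have h2 := h1.1 (by linear_combination ht)
    linear_combination h2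
  have hT : ∀ i s t, T i s t = T i 0 t := fun i s t => by
    rw [← hcross i s t 0 t (sub_zero t), ← hcross i 0 t 0 t (sub_zero t)]
  have hTS : ∀ i s t, T i s t - S i s t = T (i - 1) 0 (t - s) := fun i s t => by
    have := hcross (i - 1) 0 (t - s) s t rfl
    rwa [sub_add_cancel] at this
  have h3 : (3 : ZMod 3) = 0 := rfl
  refine false_of_shift_system h.odd (fun i t => T i 0 t) ?_ ?_ ?_ ?_
  · intro i x y x' y' hxy
    -- With t = x and s = x − y, one has t + s = −(x + y) modulo 3, so the skew relation becomes a
    -- condition on x + y.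
    have e1 := hskew i (x - y) x (x' - y') x' (by linear_combination (x' - x) * h3 + hxy)
    have e2 := hTS i (x - y) x
    have e3 := hTS (i + q) (x' - y') x'
    rw [sub_sub_cancel] at e2 e3
    have e4 := hT i (x - y) x
    have e5 := hT (i + q) (x' - y') x'
    linear_combination e1 + 2 * e4 - e2 - 2 * e5 + e3 + (T i 0 x - T (i + q) 0 x') * h3
  · intro i x
    have e1 := hST (i + 3 * q * 1) 0 (x - 1)
    have e2 := hST i 0 x
    rw [h.elt_add, h.elt_add, Int.cast_one, sub_add_cancel, e2] at e1
    have e3 := (h.elt_inj e1).2.2 rfl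
    rw [mul_one] at e3
    change T (i + 3 * q) 0 (x - 1) = T i 0 x - 1
    linear_combination -e3
  · have e1 := hST 0 0 0
    rw [elt_zero, hf1, ← elt_zero (a := a) (b := b) (c := c)] at e1
    exact ((h.elt_inj e1).2.2 rfl).symm
  · have e1 := hST 1 0 1
    rw [hfx] at e1
    have e2 := hTS 1 0 1
    rw [← (h.elt_inj e1).1, ← (h.elt_inj e1).2.2 rfl, sub_zero, sub_zero, sub_self] at e2
    exact e2.symm

end IsModularPair

end SchurRing

/-! ### Minimal nonabelian 3-groups. -/

namespace SchurRing

open scoped commutatorElement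

section ThreeGroups

variable {G : Type*} [Group G] [Finite G]

/-- A noncentral b of least order works. Otherwise take a not commuting with b: suitable powers of a
and b are central of order 3, hence generate the same subgroup, the one containing all commutators.
As the cube map is multiplicative, multiplying b by a power of a lowers its order and keeps it
noncentral. -/
theorem exists_not_mem_center_cube_eq_one (hG : IsPGroup 3 G)
    (h : ∀ x y : G, ⁅x, y⁆ ∈ Subgroup.center G) (h3 : ∀ x y : G, ⁅x, y⁆ ^ 3 = 1)
    (hmem : ∀ z ∈ Subgroup.center G, z ≠ 1 → ∀ x y : G, ⁅x, y⁆ ∈ Subgroup.zpowers z)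
    (hcube : ∀ g : G, g ^ 3 ∈ Subgroup.center G) (hne : Subgroup.center G ≠ ⊤) :
    ∃ b ∉ Subgroup.center G, b ^ 3 = 1 := by
  obtain ⟨b, hb, hmin⟩ := Set.exists_min_image {g : G | g ∉ Subgroup.center G} orderOf
    (Set.toFinite _) (by
      by_contra hempty
      exact hne ((Subgroup.eq_top_iff' _).2 fun g => by
        by_contra hg
        exact hempty ⟨g, hg⟩))
  refine ⟨b, hb, ?_⟩
  by_contra hb3
  obtain ⟨a, hab⟩ : ∃ a, ¬ Commute a b := by
    by_contra hc
    push Not at hc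
    exact hb (Subgroup.mem_center_iff.2 fun g => hc g)
  have ha : a ∉ Subgroup.center G := fun hac => hab (Subgroup.mem_center_iff.1 hac b).symm
  obtain ⟨k, hk⟩ := IsPGroup.iff_orderOf.1 hG b
  obtain ⟨l, hl⟩ := IsPGroup.iff_orderOf.1 hG a
  have hkl : k ≤ l := by
    have := hmin a ha
    rw [hk, hl] at this
    exact (Nat.pow_le_pow_iff_right (by norm_num)).1 this
  obtain ⟨m, rfl⟩ : ∃ m, k = m + 2 := by
    rcases k with _ | _ | m
    · exact absurd (by
        have := pow_orderOf_eq_one b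
        rw [hk, pow_zero, pow_one] at this
        rw [this, one_pow]) hb3
    · exact absurd (by
        have := pow_orderOf_eq_one b
        rwa [hk, zero_add, pow_one] at this) hb3
    · exact ⟨m, rfl⟩
  obtain ⟨r, rfl⟩ := Nat.exists_eq_add_of_le hkl
  set x := a ^ 3 ^ (m + 1 + r) with hx
  set y := b ^ 3 ^ (m + 1) with hy
  have hxc : x ∈ Subgroup.center G := by
    rw [hx, show m + 1 + r = m + r + 1 by ring, pow_succ, pow_mul]
    exact hcube _
  have hyc : y ∈ Subgroup.center G := by
    rw [hy, pow_succ, pow_mul]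
    exact hcube _
  have hx1 : x ≠ 1 := by
    refine pow_ne_one_of_lt_orderOf (by positivity) ?_
    rw [hl]
    exact Nat.pow_lt_pow_right (by norm_num) (by omega)
  have hy1 : y ≠ 1 := by
    refine pow_ne_one_of_lt_orderOf (by positivity) ?_
    rw [hk]
    exact Nat.pow_lt_pow_right (by norm_num) (by omega)
  have hy3 : y ^ 3 = 1 := by
    rw [hy, ← pow_mul, ← pow_succ, ← hk, pow_orderOf_eq_one]
  have hyx : y ∈ Subgroup.zpowers x := by
    have hc1 : ⁅a, b⁆ ≠ 1 := fun hc => hab (commutatorElement_eq_one_iff_commute.1 hc)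
    have hcx := hmem x hxc hx1 a b
    obtain ⟨n, hn⟩ := Subgroup.mem_zpowers_iff.1 (hmem y hyc hy1 a b)
    rw [zpow_eq_pow_val hy3] at hn
    have h2 : y = ⁅a, b⁆ ∨ y = ⁅a, b⁆ ^ 2 := by
      rcases (n : ZMod 3).three_cases with h0 | h0 | h0 <;> rw [h0] at hn
      · rw [ZMod.val_zero, pow_zero] at hn
        exact absurd hn.symm hc1
      · left
        rw [← hn]
        exact (pow_one y).symm
      · right
        rw [← hn]
        change y = (y ^ 2) ^ 2
        rw [← pow_mul, show 2 * 2 = 3 + 1 by rfl, pow_succ, hy3, one_mul]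
    rcases h2 with h2 | h2 <;> rw [h2]
    · exact hcx
    · exact pow_mem hcx 2
  obtain ⟨e, he⟩ := Subgroup.mem_zpowers_iff.1 hyx
  set a' := a ^ (-e * 3 ^ r) with ha'
  have hba : (b * a') ^ 3 ^ (m + 1) = 1 := by
    have h2 : a' ^ 3 ^ (m + 1) = x ^ (-e) := by
      rw [ha', hx, ← zpow_natCast, ← zpow_natCast, ← zpow_mul, ← zpow_mul]
      congr 1
      push_cast
      ring
    rw [three_pow_mul h h3, h2, ← hy, zpow_neg, he, mul_inv_cancel]
  have hba' : b * a' ∉ Subgroup.center G := by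
    intro hc
    have h2 : Commute a (b * a') := Subgroup.mem_center_iff.1 hc a
    have h4 : Commute a a' := (Commute.refl a).zpow_right _
    exact hab (by simpa using h2.mul_right h4.inv_right)
  have h2 := hmin _ hba'
  rw [hk] at h2
  have h4 := Nat.le_of_dvd (by positivity) (orderOf_dvd_of_pow_eq_one hba)
  have h5 : 3 ^ (m + 1) < 3 ^ (m + 2) := Nat.pow_lt_pow_right (by norm_num) (by omega)
  omega

/-- With b of order 3 and a not commuting with it, the order of a decides: 3 and 9 give the two
groups of order 27 as subgroups, and a larger order gives a modular group. -/
theorem IsPGroup.not_isSchurFamilyGroup_of_three (hG : IsPGroup 3 G)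
    (h : ∀ x y : G, ⁅x, y⁆ ∈ Subgroup.center G) (h3 : ∀ x y : G, ⁅x, y⁆ ^ 3 = 1)
    (hmem : ∀ z ∈ Subgroup.center G, z ≠ 1 → ∀ x y : G, ⁅x, y⁆ ∈ Subgroup.zpowers z)
    (hgen : ∀ x y : G, ¬ Commute x y → Subgroup.closure {x, y} = ⊤)
    (hne : Subgroup.center G ≠ ⊤) : ¬ IsSchurFamilyGroup G := by
  have hcube : ∀ g : G, g ^ 3 ∈ Subgroup.center G := fun g => Subgroup.mem_center_iff.2 fun w => by
    have : commHom h w (g ^ 3) = 1 := by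
      rw [map_pow]
      exact Subtype.ext (h3 g w)
    exact (commHom_eq_one_iff.1 this).symm
  obtain ⟨b, hb, hb3⟩ := exists_not_mem_center_cube_eq_one hG h h3 hmem hcube hne
  obtain ⟨a, hab⟩ : ∃ a, ¬ Commute a b := by
    by_contra hc
    push Not at hc
    exact hb (Subgroup.mem_center_iff.2 fun g => hc g)
  have hcc := h b⁻¹ a⁻¹
  have hc3 := h3 b⁻¹ a⁻¹
  have hba : b * a = a * b * ⁅b⁻¹, a⁻¹⁆ := by
    rw [commutatorElement_def]
    group
  have hcmem := fun z hz hz1 => hmem z hz hz1 b⁻¹ a⁻¹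
  have hc1 : ⁅b⁻¹, a⁻¹⁆ ≠ 1 := by
    intro hc
    rw [hc, mul_one] at hba
    exact hab hba.symm
  generalize ⁅b⁻¹, a⁻¹⁆ = c at *
  have hcomm : ∀ {z}, z ∈ Subgroup.center G → ∀ g, Commute z g := fun hz g =>
    (Subgroup.mem_center_iff.1 hz g).symm
  by_cases ha3 : a ^ 3 = 1
  · exact not_isSchurFamilyGroup_of_ext27 (ε := 0) (Or.inl rfl) hc3 hb3 (hcomm hcc a)
      (hcomm hcc b) hba (by rw [ha3, ZMod.val_zero, pow_zero, one_mul]) hc1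
  obtain ⟨l, hl⟩ := IsPGroup.iff_orderOf.1 hG a
  obtain ⟨m, rfl⟩ : ∃ m, l = m + 2 := by
    rcases l with _ | _ | m
    · exact absurd (by
        have := pow_orderOf_eq_one a
        rw [hl, pow_zero, pow_one] at this
        rw [this, one_pow]) ha3
    · exact absurd (by
        have := pow_orderOf_eq_one a
        rwa [hl, zero_add, pow_one] at this) ha3
    · exact ⟨m, rfl⟩
  obtain ⟨x, hx⟩ : ∃ x, x = a ^ 3 ^ (m + 1) := ⟨_, rfl⟩
  have hxc : x ∈ Subgroup.center G := by
    rw [hx, pow_succ, pow_mul]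
    exact hcube _
  have hx1 : x ≠ 1 := by
    rw [hx]
    refine pow_ne_one_of_lt_orderOf (by positivity) ?_
    rw [hl]
    exact Nat.pow_lt_pow_right (by norm_num) (by omega)
  have hx3 : x ^ 3 = 1 := by
    rw [hx, ← pow_mul, ← pow_succ, ← hl, pow_orderOf_eq_one]
  -- The commutator c is x or its inverse; replacing b by its inverse adjusts the sign.
  obtain ⟨b', hb3', hab'⟩ : ∃ b', b' ^ 3 = 1 ∧ a * b' = b' * x * a := by
    obtain ⟨n, hn⟩ := Subgroup.mem_zpowers_iff.1 (hcmem x hxc hx1)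
    rw [zpow_eq_pow_val hx3] at hn
    rcases (n : ZMod 3).three_cases with h0 | h0 | h0 <;> rw [h0] at hn
    · rw [ZMod.val_zero, pow_zero] at hn
      exact absurd hn.symm hc1
    · refine ⟨b⁻¹, by rw [inv_pow, hb3, inv_one], ?_⟩
      have hn' : x = c := by
        rw [← hn]
        exact (pow_one x).symm
      rw [hn', mul_assoc, (hcomm hcc a).eq, eq_inv_mul_iff_mul_eq, ← mul_assoc, hba,
        mul_assoc _ c, (hcomm hcc b⁻¹).eq]
      group
    · refine ⟨b, hb3, ?_⟩
      have hn' : x = c⁻¹ := by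
        rw [← hn, eq_inv_iff_mul_eq_one]
        exact (pow_succ' x 2).symm.trans hx3
      rw [mul_assoc, (hcomm hxc a).eq, ← mul_assoc, hba, hn', mul_inv_cancel_right]
  rcases m with _ | m
  · refine not_isSchurFamilyGroup_of_ext27 (a := a) (b := b') (c := x⁻¹) (ε := 1) (Or.inr rfl)
      (by rw [inv_pow, hx3, inv_one]) hb3' (hcomm (inv_mem hxc) a) (hcomm (inv_mem hxc) b') ?_ ?_
      (inv_ne_one.2 hx1)
    · rw [hab', mul_assoc b', (hcomm hxc a).eq, ← mul_assoc, mul_inv_cancel_right]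
    · change a ^ 3 * (x⁻¹) ^ 1 = 1
      rw [pow_one, hx, zero_add, pow_one, mul_inv_cancel]
  -- Here `a` has order 3^(m+3) = 9q, so q = 3^(m+1) makes x equal to a^(3q).
  · refine IsModularPair.not_isSchurFamilyGroup (q := 3 ^ (m + 1)) (a := a) (b := b') (c := x)
      ⟨dvd_pow_self 3 (by omega), Odd.pow (by decide), hb3', hx3, hcomm hxc b', hcomm hxc a, hab',
        ?_, ?_, ?_⟩
    · rw [hx, ← pow_succ']
    · intro i hi
      have := orderOf_dvd_iff_zpow_eq_one.2 hi
      rw [hl] at this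
      convert this using 1
      push_cast
      ring
    · intro g
      have hnab : ¬ Commute a b' := by
        intro hc
        have h1 := hc.eq
        rw [hab', mul_assoc] at h1
        exact hx1 (mul_eq_right.1 (mul_left_cancel h1))
      have hxa : Subgroup.zpowers x ≤ Subgroup.zpowers a := by
        rw [Subgroup.zpowers_le, hx]
        exact pow_mem (Subgroup.mem_zpowers a) _
      -- The cyclic group of `a` contains x, hence all commutators.
      have hN : (Subgroup.zpowers a).Normal := ⟨fun y hy g => by
        have h1 := mul_mem (hxa (hmem x hxc hx1 g y)) hy
        rwa [commutatorElement_def, inv_mul_cancel_right] at h1⟩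
      have hg : g ∈ Subgroup.zpowers b' ⊔ Subgroup.zpowers a := by
        have h1 : Subgroup.closure {a, b'} ≤ Subgroup.zpowers b' ⊔ Subgroup.zpowers a := by
          rw [Subgroup.closure_le]
          rintro y (rfl | rfl)
          · exact Subgroup.mem_sup_right (Subgroup.mem_zpowers y)
          · exact Subgroup.mem_sup_left (Subgroup.mem_zpowers y)
        rw [hgen a b' hnab] at h1
        exact h1 (Subgroup.mem_top g)
      obtain ⟨y, hy, z, hz, rfl⟩ := Subgroup.mem_sup_of_normal_right.1 hg
      obtain ⟨n, rfl⟩ := Subgroup.mem_zpowers_iff.1 hy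
      obtain ⟨i, rfl⟩ := Subgroup.mem_zpowers_iff.1 hz
      exact ⟨_, i, by rw [zpow_eq_pow_val hb3']⟩

end ThreeGroups

-- The minimal counterexample.

universe u

/-- Induction on the order makes all proper subgroups and proper quotients abelian, so commutators
lie in every nontrivial normal subgroup; the centre and its cyclic subgroups are the ones needed. -/
theorem commute_of_isSchurFamilyGroup {p : ℕ} (hp : p.Prime) (hodd : Odd p) (n : ℕ) :
    ∀ (G : Type u) [Group G] [Finite G], Nat.card G = n → IsPGroup p G → IsSchurFamilyGroup G →
      ∀ x y : G, Commute x y := by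
  induction n using Nat.strong_induction_on with
  | _ n ih =>
  intro G _ _ hn hG hS
  have : Fact p.Prime := ⟨hp⟩
  by_contra hnc
  push Not at hnc
  obtain ⟨a, b, hab⟩ := hnc
  have hsub : ∀ H : Subgroup G, H ≠ ⊤ → ∀ x ∈ H, ∀ y ∈ H, Commute x y := by
    intro H hH x hx y hy
    have hlt : Nat.card H < n := hn ▸ lt_of_le_of_ne (Subgroup.card_le_card_group H)
      fun hc => hH (Subgroup.card_eq_iff_eq_top H |>.1 hc)
    exact congrArg Subtype.val (ih _ hlt H rfl (hG.to_subgroup H)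
      (hS.of_injective H.subtype H.subtype_injective) ⟨x, hx⟩ ⟨y, hy⟩).eq
  have hquo : ∀ N : Subgroup G, N.Normal → N ≠ ⊥ → ∀ x y : G, ⁅x, y⁆ ∈ N := by
    intro N hN hbot x y
    have hlt : Nat.card (G ⧸ N) < n := by
      rw [← hn, Subgroup.card_eq_card_quotient_mul_card_subgroup N]
      exact lt_mul_of_one_lt_right Nat.card_pos ((Subgroup.one_lt_card_iff_ne_bot N).2 hbot)
    have := ih _ hlt (G ⧸ N) rfl (hG.to_quotient N)
      (hS.of_surjective (QuotientGroup.mk' N) (QuotientGroup.mk'_surjective N)) x y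
    rw [← QuotientGroup.eq_one_iff]
    exact commutatorElement_eq_one_iff_commute.2 this
  have hmem : ∀ z ∈ Subgroup.center G, z ≠ 1 → ∀ x y : G, ⁅x, y⁆ ∈ Subgroup.zpowers z := by
    intro z hz hz1
    refine hquo _ ⟨fun y hy g => ?_⟩ ?_
    · rwa [Subgroup.mem_center_iff.1 (Subgroup.zpowers_le.2 hz hy) g, mul_inv_cancel_right]
    rwa [Ne, Subgroup.zpowers_eq_bot]
  have : Nontrivial G := ⟨a, b, fun hc => hab (hc ▸ Commute.refl a)⟩
  have hcen : Nontrivial (Subgroup.center G) := hG.center_nontrivial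
  have h : ∀ x y : G, ⁅x, y⁆ ∈ Subgroup.center G :=
    hquo _ inferInstance ((Subgroup.nontrivial_iff_ne_bot _).1 hcen)
  have hpow : ∀ x y : G, ⁅x, y⁆ ^ p = 1 := by
    obtain ⟨z, hz⟩ := exists_ne (1 : Subgroup.center G)
    have hz1 : (z : G) ≠ 1 := fun hc => hz (Subtype.ext hc)
    obtain ⟨k, hk⟩ := IsPGroup.iff_orderOf.1 hG z
    rcases k with _ | k
    · rw [pow_zero, orderOf_eq_one_iff] at hk
      exact absurd hk hz1
    -- This power of z is central of order p and generates a group containing all commutators, which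
    -- bounds their order.
    have hw1 : (z : G) ^ p ^ k ≠ 1 := by
      refine pow_ne_one_of_lt_orderOf (pow_ne_zero _ hp.ne_zero) ?_
      rw [hk]
      exact Nat.pow_lt_pow_right hp.one_lt (by omega)
    intro x y
    obtain ⟨i, hi⟩ := Subgroup.mem_zpowers_iff.1 (hmem _ (pow_mem z.2 _) hw1 x y)
    rw [← hi, ← zpow_natCast, zpow_comm, zpow_natCast, ← pow_mul, ← pow_succ, ← hk,
      pow_orderOf_eq_one, one_zpow]
  have hgen : ∀ x y : G, ¬ Commute x y → Subgroup.closure {x, y} = ⊤ := by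
    intro x y hxy
    by_contra hc
    exact hxy (hsub _ hc x (Subgroup.subset_closure (by simp)) y
      (Subgroup.subset_closure (by simp)))
  by_cases hp3 : p = 3
  · subst hp3
    refine IsPGroup.not_isSchurFamilyGroup_of_three hG h hpow hmem hgen ?_ hS
    intro hc
    have : a ∈ Subgroup.center G := hc ▸ Subgroup.mem_top a
    exact hab (Subgroup.mem_center_iff.1 this b).symm
  · have hne : commHom h a b ≠ 1 := fun hc => hab (commHom_eq_one_iff.1 hc).symm
    have hp1 : commHom h a b ^ p = 1 := Subtype.ext (hpow b a)
    -- The commutator of a and b has order p, and p is neither 2 nor 3, so its square and cube are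
    -- nontrivial.
    have hcop : ∀ m : ℕ, Nat.Coprime m p → commHom h a b ^ m ≠ 1 := by
      intro m hm hc
      have := Nat.dvd_gcd (orderOf_dvd_of_pow_eq_one hc) (orderOf_dvd_of_pow_eq_one hp1)
      rw [hm.gcd_eq_one, Nat.dvd_one, orderOf_eq_one_iff] at this
      exact hne this
    exact not_isSchurFamilyGroup_of_not_commute_pow h hgen hab
      (hcop 2 (Nat.coprime_two_left.2 hodd))
      (hcop 3 ((Nat.coprime_primes Nat.prime_three hp).2 (Ne.symm hp3))) hS

end SchurRing

theorem mainTheorem4 (p : ℕ) (hp : p.Prime) (hodd : Odd p)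
    (G : Type*) [Group G] (hpG : IsPGroup p G) (hG : SchurRing.IsSchurGroup G) :
    ∀ x y : G, x * y = y * x := by
  have : Finite G := hG.1
  exact SchurRing.commute_of_isSchurFamilyGroup hp hodd _ G rfl hpG hG.isSchurFamilyGroup
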